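/- Let $\varphi:(0,\infty)\to(0,\infty)$ satisfy: (i) $\varphi\in C^1((0,\infty))$; (ii) $(s\varphi(s))'>0$ for all $s>0$; (iii) the range of $s\mapsto s\varphi(s)$ on $(0,\infty)$ is $(0,\infty)$; (iv) there are constants $C_1,C_2,s_0>0$ and $r>-1$ with $C_1s^r\le (s\varphi(s))'\le C_2s^r$ for $0<s<s_0$, and, if $r=0$, moreover $\lim_{s\to0^+}\varphi(s)$ exists, is finite and positive, and $\lim_{s\to0^+}s\varphi'(s)=0$; (v) there is $s_1>s_0$ such that either $\varphi'\ge0$ on $[s_1,\infty)$ or $\varphi'\le0$ on $[s_1,\infty)$; (vi) $s\mapsto|s\varphi'(s)/\varphi(s)|$ is non-decreasing on $(0,\infty)$. Let $\Lambda:(0,\infty)\to\mathbb R$ be the function defined by $$\Lambda\bigl(s\sqrt{\varphi(s)}\bigr)=-\frac{s\varphi'(s)}{s\varphi'(s)+2\varphi(s)},\qquad s>0 .$$ Let $(a,b)\subset\mathbb R$ be a bounded or unbounded open interval, and let $\mathscr A(x)=\{a_{ij}(x)\}$ be an $m\times m$ matrix with complex entries $a_{ij}\in L^1_{loc}((a,b))$.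 Write $\langle\xi,\eta\rangle=\sum_j\xi_j\overline{\eta_j}$ on $\mathbb C^m$. The operator $Au=(\mathscr A(x)u')'$ is called $L^\Phi$-dissipative if $$\operatorname{Re}\int_a^b\langle\mathscr A\,u',(\varphi(|u|)u)'\rangle\,dx\ge0$$ for every $u\in[C^1_c((a,b))]^m$ such that $\varphi(|u|)u\in[C^1_c((a,b))]^m$, where $\varphi(|u|)u$ is understood as $0$ wherever $u=0$. Then the finite limit $\Lambda_\infty=\lim_{t\to\infty}\Lambda(t)$ exists, and $A$ is $L^\Phi$-dissipative if and only if, for almost every $x\in(a,b)$ and for all $\lambda,\omega\in\mathbb C^m$ with $|\omega|=1$, $$\operatorname{Re}\langle\mathscr A(x)\lambda,\lambda\rangle-\Lambda_\infty^2\operatorname{Re}\langle\mathscr A(x)\omega,\omega\rangle(\operatorname{Re}\langle\lambda,\omega\rangle)^2+\Lambda_\infty\operatorname{Re}\bigl(\langle\mathscr A(x)\omega,\lambda\rangle-\langle\mathscr A(x)\lambda,\omega\rangle\bigr)\operatorname{Re}\langle\lambda,\omega\rangle\ge0 .$$ -/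

import Mathlib

open Set Filter Topology MeasureTheory

noncomputable section

namespace FunctionalDissipativity

/-- The standing assumptions on the positive function `φ : (0,∞) → (0,∞)`.  Only the values of `φ`
on `(0,∞)` matter; `φ` is represented by a function on `ℝ`. -/
structure Admissible (φ : ℝ → ℝ) : Prop where
  pos : ∀ s, 0 < s → 0 < φ s
  contDiffOn : ContDiffOn ℝ 1 φ (Ioi 0)
  deriv_pos : ∀ s, 0 < s → 0 < deriv (fun t => t * φ t) s
  range_eq : (fun s => s * φ s) '' Ioi 0 = Ioi 0
  /-- Behaviour near `0` (with the supplementary requirement when `r = 0`), and constant sign of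
  `φ'` near infinity. -/
  growth : ∃ C₁ C₂ r s₀ : ℝ, 0 < C₁ ∧ 0 < C₂ ∧ -1 < r ∧ 0 < s₀ ∧
    (∀ s ∈ Ioo 0 s₀, C₁ * s ^ r ≤ deriv (fun t => t * φ t) s ∧
      deriv (fun t => t * φ t) s ≤ C₂ * s ^ r) ∧
    (r = 0 → (∃ l : ℝ, 0 < l ∧ Tendsto φ (𝓝[>] 0) (𝓝 l)) ∧
      Tendsto (fun s => s * deriv φ s) (𝓝[>] 0) (𝓝 0)) ∧
    ∃ s₁, s₀ < s₁ ∧ ((∀ s, s₁ ≤ s → 0 ≤ deriv φ s) ∨ (∀ s, s₁ ≤ s → deriv φ s ≤ 0))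
  monotone_abs : MonotoneOn (fun s => |s * deriv φ s / φ s|) (Ioi 0)

/-- The inverse of the function `s ↦ s √(φ s)` on `(0,∞)`. -/
def invMulSqrt (φ : ℝ → ℝ) : ℝ → ℝ :=
  Function.invFunOn (fun s => s * √(φ s)) (Ioi 0)

/-- The function `Λ` on `(0,∞)`, given by
`Λ (s √(φ s)) = - s φ'(s) / (s φ'(s) + 2 φ(s))` for `s > 0`; see `Lambda_mul_sqrt`. -/
def Lambda (φ : ℝ → ℝ) (t : ℝ) : ℝ :=
  -(invMulSqrt φ t * deriv φ (invMulSqrt φ t)) /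
    (invMulSqrt φ t * deriv φ (invMulSqrt φ t) + 2 * φ (invMulSqrt φ t))

theorem Admissible.strictMonoOn_mul_sqrt {φ : ℝ → ℝ} (hφ : Admissible φ) :
    StrictMonoOn (fun s => s * √(φ s)) (Ioi 0) := by
  have hm : StrictMonoOn (fun s => s * φ s) (Ioi 0) := by
    apply strictMonoOn_of_deriv_pos (convex_Ioi 0)
    · exact continuousOn_id.mul hφ.contDiffOn.continuousOn
    · intro x hx
      rw [interior_Ioi] at hx
      exact hφ.deriv_pos x hx
  intro x hx y hy hxy
  have hx0 : 0 < x := hx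
  have hy0 : 0 < y := hy
  have h1 : x * φ x < y * φ y := hm hx hy hxy
  have h0 : 0 < x * φ x := mul_pos hx0 (hφ.pos x hx0)
  have e : ∀ s, 0 < s → s * √(φ s) = √(s * (s * φ s)) := by
    intro s hs
    rw [← mul_assoc, Real.sqrt_mul (mul_self_nonneg s), Real.sqrt_mul_self hs.le]
  change x * √(φ x) < y * √(φ y)
  rw [e x hx0, e y hy0]
  exact Real.sqrt_lt_sqrt (mul_pos hx0 h0).le (mul_lt_mul'' hxy h1 hx0.le h0.le)

/-- The defining relation of `Λ`. -/
theorem Admissible.Lambda_mul_sqrt {φ : ℝ → ℝ} (hφ : Admissible φ) {s : ℝ} (hs : 0 < s) :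
    Lambda φ (s * √(φ s)) = -(s * deriv φ s) / (s * deriv φ s + 2 * φ s) := by
  have h : invMulSqrt φ (s * √(φ s)) = s :=
    hφ.strictMonoOn_mul_sqrt.injOn.leftInvOn_invFunOn (show s ∈ Ioi (0 : ℝ) from hs)
  simp only [Lambda, h]

/-- The bounded or unbounded open interval `(a,b) ⊆ ℝ`, with `a, b ∈ [-∞, +∞]`. -/
def openInterval (a b : EReal) : Set ℝ := {x : ℝ | a < (x : EReal) ∧ (x : EReal) < b}

/-- `ℂ^m` with its Euclidean norm. -/
abbrev Cvec (m : ℕ) : Type := EuclideanSpace ℂ (Fin m)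

/-- The scalar product `⟨x, y⟩ = ∑ j, x j * conj (y j)`, linear in the first argument. -/
def sprod {m : ℕ} (x y : Cvec m) : ℂ := inner ℂ y x

/-- The matrix-vector product `M v`. -/
def matVec {m : ℕ} (M : Matrix (Fin m) (Fin m) ℂ) (v : Cvec m) : Cvec m :=
  WithLp.toLp 2 (M.mulVec v.ofLp)

/-- `u ∈ [C_c^1(I)]^m`: continuously differentiable, with compact support contained in `I`
(`u` is identified with its extension by zero). -/
def IsTestFun {m : ℕ} (I : Set ℝ) (u : ℝ → Cvec m) : Prop :=
  ContDiff ℝ 1 u ∧ HasCompactSupport u ∧ tsupport u ⊆ I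

/-- `φ(|u|) u`, which is zero where `u` vanishes. -/
def weighted {m : ℕ} (φ : ℝ → ℝ) (u : ℝ → Cvec m) : ℝ → Cvec m :=
  fun x => φ ‖u x‖ • u x

/-- `L^Φ`-dissipativity of the operator `u ↦ (𝒜 u')'` on the interval `I`:
`Re ∫_I ⟨𝒜 u', (φ(|u|) u)'⟩ dx ≥ 0` for all `u ∈ [C_c^1(I)]^m` with `φ(|u|) u ∈ [C_c^1(I)]^m`. -/
def IsDissipative {m : ℕ} (φ : ℝ → ℝ) (I : Set ℝ) (𝒜 : ℝ → Matrix (Fin m) (Fin m) ℂ) : Prop :=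
  ∀ u : ℝ → Cvec m, IsTestFun I u → IsTestFun I (weighted φ u) →
    0 ≤ (∫ x in I, sprod (matVec (𝒜 x) (deriv u x)) (deriv (weighted φ u) x)).re

end FunctionalDissipativity

end

/-!
Let `D(z)` be the differential at `z ≠ 0` of the radial map `z ↦ φ(|z|) z`. Where `u ≠ 0` the
integrand is `⟨𝒜 u', D(u) u'⟩`, and where `u = 0` the derivatives of `u` and of `φ(|u|) u` point in
the same direction. So it suffices that `⟨𝒜 v, D(z) v⟩ ≥ 0` for all `v` and all `z ≠ 0`. This is
also necessary: on a compact set take `u = z + S v`, where `S` is small but oscillates so fast that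
`S'` does not vanish in the limit, average over two phases, and let the amplitude concentrate at a
Lebesgue point of `𝒜 v`.

For `z = s ω` with `|ω| = 1` one has `D(z) = φ(s) (1 + p ω ⊗ ω)` with `p = s φ'(s) / φ(s)`, and
substituting a suitable axial stretch of `l` for `v` turns `⟨𝒜 v, D(z) v⟩` into `φ(s)` times the
form of the theorem, with `Λ(s √(φ(s))) = -p / (p + 2)` in place of `Λ_∞`. As `|p|` is monotone and
`p` does not change sign, these values lie between `0` and `Λ_∞` and tend to `Λ_∞`. Nonnegativity
of the form for `Λ_∞` in turn implies it for all the others: for `⟨ω, l⟩ = 0` it gives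
`⟨𝒜 l, l⟩ ≥ 0`, and for `0 ≤ θ ≤ 1` the form with parameter `θ Λ_∞` is a convex combination of those
with parameters `0` and `Λ_∞` plus a nonnegative multiple of `⟨𝒜 ω, ω⟩`.
-/

noncomputable section

namespace FunctionalDissipativity

open scoped RealInnerProductSpace NNReal

section MonotoneAbs

variable {f : ℝ → ℝ}

theorem forall_nonneg_or_forall_nonpos_of_monotoneOn_abs {S : Set ℝ} [S.OrdConnected]
    (hf : ContinuousOn f S) (hmono : MonotoneOn (fun s => |f s|) S) :
    (∀ s ∈ S, 0 ≤ f s) ∨ ∀ s ∈ S, f s ≤ 0 := by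
  by_contra! h
  obtain ⟨⟨s, hs, hfs⟩, t, ht, hft⟩ := h
  have hst : uIcc s t ⊆ S := OrdConnected.uIcc_subset ‹_› hs ht
  obtain ⟨r, hr, hfr⟩ := intermediate_value_uIcc (hf.mono hst)
    (mem_uIcc.mpr (Or.inl ⟨hfs.le, hft.le⟩))
  have eq_zero_of_le : ∀ x ∈ S, x ≤ r → f x = 0 := fun x hx hxr => by
    have := hmono hx (hst hr) hxr
    simpa only [hfr, abs_zero, abs_nonpos_iff] using this
  rcases le_total s t with hle | hle
  · exact hfs.ne (eq_zero_of_le s hs (uIcc_of_le hle ▸ hr).1)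
  · exact hft.ne' (eq_zero_of_le t ht (uIcc_of_ge hle ▸ hr).1)

theorem exists_tendsto_atTop_of_monotoneOn_abs {a C : ℝ} (hf : ContinuousOn f (Ioi a))
    (hmono : MonotoneOn (fun s => |f s|) (Ioi a)) (hC : ∀ s ∈ Ioi a, |f s| ≤ C) :
    ∃ L, Tendsto f atTop (𝓝 L) ∧ ∀ s ∈ Ioi a, f s ∈ segment ℝ 0 L := by
  wlog hnonneg : ∀ s ∈ Ioi a, 0 ≤ f s generalizing f
  · have hnonpos :=
      (forall_nonneg_or_forall_nonpos_of_monotoneOn_abs hf hmono).resolve_left hnonneg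
    obtain ⟨L, hL, hseg⟩ := this (f := fun s => -f s) hf.neg (by simpa only [abs_neg] using hmono)
      (by simpa only [abs_neg] using hC) fun s hs => neg_nonneg.mpr (hnonpos s hs)
    refine ⟨-L, by simpa only [neg_neg] using hL.neg, fun s hs => ?_⟩
    obtain ⟨θ, hθ, hfs⟩ := (segment_eq_image' ℝ 0 L ▸ hseg s hs :)
    rw [segment_eq_image']
    refine ⟨θ, hθ, ?_⟩
    simp only [smul_eq_mul, sub_zero, zero_add] at hfs ⊢
    linarith
  have hlt : ∀ s, a < max s (a + 1) := fun s => (lt_add_one a).trans_le (le_max_right _ _)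
  have hfmono : MonotoneOn f (Ioi a) :=
    hmono.congr fun s hs => abs_of_nonneg (hnonneg s hs)
  have hgmono : Monotone fun s => f (max s (a + 1)) := fun s t hst =>
    hfmono (hlt s) (hlt t) (max_le_max_right _ hst)
  have hbdd : BddAbove (range fun s => f (max s (a + 1))) :=
    ⟨C, forall_mem_range.mpr fun s => (le_abs_self _).trans (hC _ (hlt s))⟩
  refine ⟨_, (tendsto_atTop_ciSup hgmono hbdd).congr' ?_, fun s hs => ?_⟩
  · filter_upwards [eventually_ge_atTop (a + 1)] with s hs
    rw [max_eq_left hs]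
  · have hle := (hfmono hs (hlt s) (le_max_left _ _)).trans (le_ciSup hbdd s)
    rw [segment_eq_Icc ((hnonneg s hs).trans hle)]
    exact ⟨hnonneg s hs, hle⟩

end MonotoneAbs

/-- The logarithmic derivative `d log φ / d log s`; it is `p - 2` for the power
`φ s = s ^ (p - 2)`, which corresponds to `L^p`-dissipativity. -/
def logIndex (φ : ℝ → ℝ) (s : ℝ) : ℝ := s * deriv φ s / φ s

/-- The value of `Λ` at `s √(φ s)`, as a function of the index `p = s φ'(s) / φ(s)`. -/
def lambdaOfIndex (p : ℝ) : ℝ := -p / (p + 2)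

theorem abs_lambdaOfIndex_le_one {p : ℝ} (hp : -1 < p) : |lambdaOfIndex p| ≤ 1 := by
  have h : 0 < p + 2 := by linarith
  rw [lambdaOfIndex, abs_div, abs_of_pos h, div_le_one h, abs_le]
  constructor <;> linarith

theorem abs_lambdaOfIndex_le_abs {p q : ℝ} (hp : -1 < p) (hq : -1 < q) (hpq : 0 ≤ p * q)
    (hle : |p| ≤ |q|) : |lambdaOfIndex p| ≤ |lambdaOfIndex q| := by
  have hp' : 0 < p + 2 := by linarith
  have hq' : 0 < q + 2 := by linarith
  rw [lambdaOfIndex, lambdaOfIndex, abs_div, abs_div, abs_neg, abs_neg, abs_of_pos hp',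
    abs_of_pos hq', div_le_div_iff₀ hp' hq']
  have hcross : |p| * q = |q| * p := by
    rcases mul_nonneg_iff.mp hpq with h | h
    · rw [abs_of_nonneg h.1, abs_of_nonneg h.2, mul_comm]
    · rw [abs_of_nonpos h.1, abs_of_nonpos h.2]; ring
  linarith

theorem mul_sqrt_eq_sqrt_mul {s : ℝ} (hs : 0 ≤ s) (c : ℝ) : s * √c = √(s * (s * c)) := by
  rw [← mul_assoc, Real.sqrt_mul (mul_self_nonneg s), Real.sqrt_mul_self hs]

/-- The properties of a weight `φ` on `(0, ∞)` on which the characterization of dissipativity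
rests: `s φ(s)` is a `C¹` function with positive derivative, and the modulus of the index
`s φ'(s) / φ(s)` is non-decreasing. -/
structure HasMonotoneIndex (φ : ℝ → ℝ) : Prop where
  pos : ∀ s, 0 < s → 0 < φ s
  contDiffOn : ContDiffOn ℝ 1 φ (Ioi 0)
  deriv_pos : ∀ s, 0 < s → 0 < deriv (fun t => t * φ t) s
  monotone_abs : MonotoneOn (fun s => |logIndex φ s|) (Ioi 0)

theorem Admissible.hasMonotoneIndex {φ : ℝ → ℝ} (hφ : Admissible φ) : HasMonotoneIndex φ :=
  ⟨hφ.pos, hφ.contDiffOn, hφ.deriv_pos, hφ.monotone_abs⟩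

namespace HasMonotoneIndex

variable {φ : ℝ → ℝ} {s : ℝ}

theorem contDiffAt (hφ : HasMonotoneIndex φ) (hs : 0 < s) : ContDiffAt ℝ 1 φ s :=
  hφ.contDiffOn.contDiffAt (Ioi_mem_nhds hs)

theorem hasDerivAt (hφ : HasMonotoneIndex φ) (hs : 0 < s) : HasDerivAt φ (deriv φ s) s :=
  ((hφ.contDiffAt hs).differentiableAt one_ne_zero).hasDerivAt

theorem mul_deriv (hφ : HasMonotoneIndex φ) (hs : 0 < s) :
    s * deriv φ s = logIndex φ s * φ s :=
  (div_mul_cancel₀ _ (hφ.pos s hs).ne').symm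

theorem neg_one_lt_logIndex (hφ : HasMonotoneIndex φ) (hs : 0 < s) : -1 < logIndex φ s := by
  have h := hφ.deriv_pos s hs
  rw [((hasDerivAt_id' s).fun_mul (hφ.hasDerivAt hs)).deriv, hφ.mul_deriv hs, ← add_mul] at h
  linarith [pos_of_mul_pos_left h (hφ.pos s hs).le]

theorem continuousOn_logIndex (hφ : HasMonotoneIndex φ) : ContinuousOn (logIndex φ) (Ioi 0) :=
  (continuousOn_id.mul (hφ.contDiffOn.continuousOn_deriv_of_isOpen isOpen_Ioi le_rfl)).div
    hφ.contDiffOn.continuousOn fun s hs => (hφ.pos s hs).ne'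

theorem strictMonoOn_mul_self (hφ : HasMonotoneIndex φ) :
    StrictMonoOn (fun s => s * φ s) (Ioi 0) :=
  strictMonoOn_of_deriv_pos (convex_Ioi 0) (continuousOn_id.mul hφ.contDiffOn.continuousOn)
    fun s hs => hφ.deriv_pos s (interior_subset hs)

theorem logIndex_nonneg_or_nonpos (hφ : HasMonotoneIndex φ) :
    (∀ s ∈ Ioi 0, 0 ≤ logIndex φ s) ∨ ∀ s ∈ Ioi 0, logIndex φ s ≤ 0 :=
  forall_nonneg_or_forall_nonpos_of_monotoneOn_abs hφ.continuousOn_logIndex hφ.monotone_abs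

theorem logIndex_mul_logIndex_nonneg (hφ : HasMonotoneIndex φ) {t : ℝ} (hs : 0 < s) (ht : 0 < t) :
    0 ≤ logIndex φ s * logIndex φ t := by
  rcases hφ.logIndex_nonneg_or_nonpos with h | h
  · exact mul_nonneg (h s hs) (h t ht)
  · exact mul_nonneg_of_nonpos_of_nonpos (h s hs) (h t ht)

theorem exists_tendsto_lambdaOfIndex (hφ : HasMonotoneIndex φ) :
    ∃ L, Tendsto (fun s => lambdaOfIndex (logIndex φ s)) atTop (𝓝 L) ∧
      ∀ s ∈ Ioi 0, lambdaOfIndex (logIndex φ s) ∈ segment ℝ 0 L := by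
  refine exists_tendsto_atTop_of_monotoneOn_abs (C := 1) ?_ (fun s hs t ht hst => ?_)
    fun s hs => abs_lambdaOfIndex_le_one (hφ.neg_one_lt_logIndex hs)
  · exact hφ.continuousOn_logIndex.neg.div (hφ.continuousOn_logIndex.add continuousOn_const)
      fun s hs => by linarith [hφ.neg_one_lt_logIndex hs]
  · exact abs_lambdaOfIndex_le_abs (hφ.neg_one_lt_logIndex hs) (hφ.neg_one_lt_logIndex ht)
      (hφ.logIndex_mul_logIndex_nonneg hs ht) (hφ.monotone_abs hs ht hst)

theorem exists_lt_one_forall_neg_le_logIndex (hφ : HasMonotoneIndex φ) :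
    ∃ q < 1, ∀ s ∈ Ioc 0 1, -q ≤ logIndex φ s := by
  rcases hφ.logIndex_nonneg_or_nonpos with h | h
  · exact ⟨0, one_pos, fun s hs => by simpa only [neg_zero] using h s hs.1⟩
  · refine ⟨-logIndex φ 1, by linarith [hφ.neg_one_lt_logIndex one_pos], fun s hs => ?_⟩
    have hle := hφ.monotone_abs hs.1 (mem_Ioi.mpr one_pos) hs.2
    simp only [abs_of_nonpos (h s hs.1), abs_of_nonpos (h 1 (mem_Ioi.mpr one_pos))] at hle
    linarith

theorem monotoneOn_rpow_mul (hφ : HasMonotoneIndex φ) {q : ℝ}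
    (hq : ∀ s ∈ Ioc 0 1, -q ≤ logIndex φ s) : MonotoneOn (fun s => s ^ q * φ s) (Ioc 0 1) := by
  have hderiv : ∀ s ∈ Ioc (0 : ℝ) 1, HasDerivAt (fun s => s ^ q * φ s)
      (s ^ (q - 1) * φ s * (q + logIndex φ s)) s := fun s hs => by
    refine ((Real.hasDerivAt_rpow_const (Or.inl hs.1.ne')).fun_mul
      (hφ.hasDerivAt hs.1)).congr_deriv ?_
    rw [Real.rpow_sub_one hs.1.ne', logIndex]
    field_simp [hs.1.ne', (hφ.pos s hs.1).ne']
  refine monotoneOn_of_deriv_nonneg (convex_Ioc 0 1)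
    (fun s hs => (hderiv s hs).continuousAt.continuousWithinAt)
    (fun s hs => (hderiv s (interior_subset hs)).differentiableAt.differentiableWithinAt)
    fun s hs => ?_
  have hs := interior_subset hs
  rw [(hderiv s hs).deriv]
  exact mul_nonneg (mul_nonneg (Real.rpow_nonneg hs.1.le _) (hφ.pos s hs.1).le)
    (by linarith [hq s hs])

theorem tendsto_mul_self_zero (hφ : HasMonotoneIndex φ) :
    Tendsto (fun s => s * φ s) (𝓝[>] 0) (𝓝 0) := by
  obtain ⟨q, hq1, hq⟩ := hφ.exists_lt_one_forall_neg_le_logIndex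
  have hexp : 0 < 1 - q := sub_pos.mpr hq1
  have hlim : Tendsto (fun s : ℝ => s ^ (1 - q) * φ 1) (𝓝[>] 0) (𝓝 0) := by
    have hcont :=
      ((Real.continuousAt_rpow_const 0 (1 - q) (Or.inr hexp.le)).mul_const (φ 1)).tendsto
    rw [Real.zero_rpow hexp.ne', zero_mul] at hcont
    exact hcont.mono_left nhdsWithin_le_nhds
  refine squeeze_zero' ?_ ?_ hlim
  · filter_upwards [self_mem_nhdsWithin] with s hs
    exact mul_nonneg hs.le (hφ.pos s hs).le
  · filter_upwards [Ioc_mem_nhdsGT one_pos] with s hs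
    have hle : s ^ q * φ s ≤ φ 1 := by
      simpa only [Real.one_rpow, one_mul] using
        hφ.monotoneOn_rpow_mul hq hs (right_mem_Ioc.mpr one_pos) hs.2
    calc s * φ s = s ^ (1 - q) * (s ^ q * φ s) := by
          rw [← mul_assoc, ← Real.rpow_add hs.1, sub_add_cancel, Real.rpow_one]
      _ ≤ s ^ (1 - q) * φ 1 := by gcongr; exact Real.rpow_nonneg hs.1.le _

theorem strictMonoOn_mul_sqrt (hφ : HasMonotoneIndex φ) :
    StrictMonoOn (fun s => s * √(φ s)) (Ioi 0) := fun s hs t ht hst => by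
  have hsφ : 0 < s * φ s := mul_pos hs (hφ.pos s hs)
  simp only [mul_sqrt_eq_sqrt_mul (le_of_lt hs), mul_sqrt_eq_sqrt_mul (le_of_lt ht)]
  exact Real.sqrt_lt_sqrt (mul_pos hs hsφ).le
    (mul_lt_mul'' hst (hφ.strictMonoOn_mul_self hs ht hst) (le_of_lt hs) hsφ.le)

theorem tendsto_mul_sqrt_atTop (hφ : HasMonotoneIndex φ) :
    Tendsto (fun s => s * √(φ s)) atTop atTop := by
  refine tendsto_atTop_mono' _ ?_
    (Real.tendsto_sqrt_atTop.comp (tendsto_id.atTop_mul_const (hφ.pos 1 one_pos)))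
  filter_upwards [eventually_ge_atTop 1] with s hs
  have hs0 : 0 < s := one_pos.trans_le hs
  have hle : φ 1 ≤ s * φ s := by
    simpa only [one_mul] using hφ.strictMonoOn_mul_self.monotoneOn (mem_Ioi.mpr one_pos) hs0 hs
  rw [mul_sqrt_eq_sqrt_mul hs0.le]
  exact Real.sqrt_le_sqrt (mul_le_mul_of_nonneg_left hle hs0.le)

theorem le_invMulSqrt (hφ : HasMonotoneIndex φ) {t : ℝ} (hs : 0 < s) (hst : s * √(φ s) ≤ t) :
    s ≤ invMulSqrt φ t := by
  obtain ⟨r, hrt, hsr⟩ := ((hφ.tendsto_mul_sqrt_atTop.eventually_ge_atTop t).and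
    (eventually_ge_atTop s)).exists
  have hcont : ContinuousOn (fun s => s * √(φ s)) (Icc s r) :=
    (continuousOn_id.mul hφ.contDiffOn.continuousOn.sqrt).mono fun _ h => hs.trans_le h.1
  obtain ⟨x, hx, hxt⟩ := intermediate_value_Icc hsr hcont ⟨hst, hrt⟩
  have hpre : ∃ x ∈ Ioi 0, x * √(φ x) = t := ⟨x, hs.trans_le hx.1, hxt⟩
  have heq : invMulSqrt φ t * √(φ (invMulSqrt φ t)) = t := Function.invFunOn_eq hpre
  exact (hφ.strictMonoOn_mul_sqrt.le_iff_le hs (Function.invFunOn_mem hpre)).mp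
    (hst.trans heq.ge)

theorem tendsto_invMulSqrt_atTop (hφ : HasMonotoneIndex φ) :
    Tendsto (invMulSqrt φ) atTop atTop := by
  refine tendsto_atTop.mpr fun s => ?_
  have hpos : 0 < max s 1 := lt_max_of_lt_right one_pos
  filter_upwards [eventually_ge_atTop (max s 1 * √(φ (max s 1)))] with t ht
  exact (le_max_left s 1).trans (hφ.le_invMulSqrt hpos ht)

theorem Lambda_eq_lambdaOfIndex (hφ : HasMonotoneIndex φ) {t : ℝ} (ht : 0 < invMulSqrt φ t) :
    Lambda φ t = lambdaOfIndex (logIndex φ (invMulSqrt φ t)) := by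
  rw [Lambda, hφ.mul_deriv ht, lambdaOfIndex, ← add_mul, ← neg_mul,
    mul_div_mul_right _ _ (hφ.pos _ ht).ne']

theorem tendsto_Lambda (hφ : HasMonotoneIndex φ) {L : ℝ}
    (hL : Tendsto (fun s => lambdaOfIndex (logIndex φ s)) atTop (𝓝 L)) :
    Tendsto (Lambda φ) atTop (𝓝 L) := by
  refine (hL.comp hφ.tendsto_invMulSqrt_atTop).congr' ?_
  filter_upwards [hφ.tendsto_invMulSqrt_atTop.eventually_gt_atTop 0] with t ht
  exact (hφ.Lambda_eq_lambdaOfIndex ht).symm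

end HasMonotoneIndex

/-- The radial vector field `z ↦ φ(|z|) z`, so that `weighted φ u = radialMap φ ∘ u`; it vanishes
at `0` whatever the value `φ 0`. -/
def radialMap {F : Type*} [NormedAddCommGroup F] [NormedSpace ℝ F] (φ : ℝ → ℝ) (z : F) : F :=
  φ ‖z‖ • z

theorem radialMap_zero {F : Type*} [NormedAddCommGroup F] [NormedSpace ℝ F] (φ : ℝ → ℝ) :
    radialMap φ (0 : F) = 0 := smul_zero _

section PointwiseForm

variable {E : Type*} [NormedAddCommGroup E] [InnerProductSpace ℝ E]

section RadialMap

variable {φ : ℝ → ℝ} {z : E}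

theorem contDiffAt_radialMap (hφ : ContDiffAt ℝ 1 φ ‖z‖) (hz : z ≠ 0) :
    ContDiffAt ℝ 1 (radialMap φ) z :=
  (hφ.comp z (contDiffAt_norm ℝ hz)).smul contDiffAt_id

theorem hasFDerivAt_radialMap {φ' : ℝ} (hφ : HasDerivAt φ φ' ‖z‖) (hz : z ≠ 0) :
    HasFDerivAt (radialMap φ)
      (φ ‖z‖ • ContinuousLinearMap.id ℝ E + ((φ' / ‖z‖) • innerSL ℝ z).smulRight z) z := by
  have hnorm : HasFDerivAt (fun y : E => ‖y‖) (‖z‖⁻¹ • innerSL ℝ z) z := by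
    have h := (hasStrictFDerivAt_norm_sq z).hasFDerivAt.sqrt
      (pow_ne_zero 2 (norm_ne_zero_iff.mpr hz))
    simp only [Real.sqrt_sq (norm_nonneg _)] at h
    refine h.congr_fderiv ?_
    rw [← Nat.cast_smul_eq_nsmul ℝ, smul_smul]
    congr 1
    field_simp
    norm_num
  refine ((hφ.comp_hasFDerivAt z hnorm).smul (hasFDerivAt_id z)).congr_fderiv ?_
  simp only [Function.comp_apply, id, smul_smul, div_eq_mul_inv]

theorem fderiv_radialMap_apply {φ' : ℝ} (hφ : HasDerivAt φ φ' ‖z‖) (hz : z ≠ 0) (v : E) :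
    fderiv ℝ (radialMap φ) z v = φ ‖z‖ • v + (φ' / ‖z‖ * ⟪z, v⟫) • z := by
  rw [(hasFDerivAt_radialMap hφ hz).fderiv]
  rfl

end RadialMap

/-- The stretching of `E` along the axis `ω`: for a unit vector `ω` it multiplies the `ω`-component
by `1 + c` and fixes the orthogonal complement of `ω`. -/
def axialStretch (c : ℝ) (ω l : E) : E := l + (c * ⟪ω, l⟫) • ω

theorem axialStretch_axialStretch {ω : E} (hω : ‖ω‖ = 1) (b c : ℝ) (l : E) :
    axialStretch b ω (axialStretch c ω l) = axialStretch (b + c + b * c) ω l := by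
  simp only [axialStretch, inner_add_right, real_inner_smul_right, real_inner_self_eq_norm_sq, hω]
  module

theorem axialStretch_zero (ω l : E) : axialStretch 0 ω l = l := by
  rw [axialStretch, zero_mul, zero_smul, add_zero]

theorem axialStretch_lambdaOfIndex {p : ℝ} (hp : -1 < p) {ω : E} (hω : ‖ω‖ = 1) (l : E) :
    axialStretch p ω (axialStretch (lambdaOfIndex p) ω l) =
      axialStretch (-lambdaOfIndex p) ω l := by
  have hp2 : p + 2 ≠ 0 := by linarith
  rw [axialStretch_axialStretch hω]
  congr 1
  rw [lambdaOfIndex]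
  field_simp
  ring

theorem surjective_axialStretch_lambdaOfIndex {p : ℝ} (hp : -1 < p) {ω : E} (hω : ‖ω‖ = 1) :
    Function.Surjective (axialStretch (lambdaOfIndex p) ω) := fun v => by
  have hp2 : p + 2 ≠ 0 := by linarith
  refine ⟨axialStretch (p / 2) ω v, ?_⟩
  rw [axialStretch_axialStretch hω]
  convert axialStretch_zero ω v using 2
  rw [lambdaOfIndex]
  field_simp
  ring

theorem fderiv_radialMap_smul {φ : ℝ → ℝ} {s : ℝ} (hφ : DifferentiableAt ℝ φ s) (hφs : φ s ≠ 0)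
    (hs : 0 < s) {ω : E} (hω : ‖ω‖ = 1) (v : E) :
    fderiv ℝ (radialMap φ) (s • ω) v = φ s • axialStretch (logIndex φ s) ω v := by
  have hnorm : ‖s • ω‖ = s := by rw [norm_smul, hω, mul_one, Real.norm_of_nonneg hs.le]
  have hne : s • ω ≠ 0 := norm_pos_iff.mp (hnorm.symm ▸ hs)
  rw [fderiv_radialMap_apply (hnorm.symm ▸ hφ.hasDerivAt) hne, hnorm, axialStretch, logIndex,
    real_inner_smul_left, smul_add, smul_smul, smul_smul]
  congr 2
  field_simp

/-- The quadratic form of the characterization, in its factored form: it is the form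
`⟪A ·, ·⟫` polarized along `ω`. -/
def dissForm (A : E →L[ℝ] E) (L : ℝ) (l ω : E) : ℝ :=
  ⟪A (axialStretch L ω l), axialStretch (-L) ω l⟫

variable {A : E →L[ℝ] E} {L : ℝ}

theorem dissForm_eq (A : E →L[ℝ] E) (L : ℝ) (l ω : E) :
    dissForm A L l ω = ⟪A l, l⟫ - L ^ 2 * ⟪A ω, ω⟫ * ⟪ω, l⟫ ^ 2
      + L * (⟪A ω, l⟫ - ⟪A l, ω⟫) * ⟪ω, l⟫ := by
  simp only [dissForm, axialStretch, map_add, map_smul, inner_add_left, inner_add_right,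
    real_inner_smul_left, real_inner_smul_right]
  ring

theorem dissForm_eq_of_inner_eq_zero {l ω : E} (h : ⟪ω, l⟫ = 0) : dissForm A L l ω = ⟪A l, l⟫ := by
  rw [dissForm_eq, h]
  ring

theorem dissForm_nonneg_of_mem_segment {c : ℝ} (hc : c ∈ segment ℝ 0 L) {l ω : E}
    (hω : 0 ≤ ⟪A ω, ω⟫) (hl : 0 ≤ ⟪A l, l⟫) (h : 0 ≤ dissForm A L l ω) :
    0 ≤ dissForm A c l ω := by
  rw [segment_eq_image] at hc
  obtain ⟨θ, hθ, rfl⟩ := hc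
  have hθ' : 0 ≤ 1 - θ := sub_nonneg.mpr hθ.2
  have hinterp : dissForm A ((1 - θ) • 0 + θ • L) l ω = (1 - θ) * ⟪A l, l⟫ + θ * dissForm A L l ω
      + θ * (1 - θ) * (L ^ 2 * ⟪A ω, ω⟫ * ⟪ω, l⟫ ^ 2) := by
    simp only [dissForm_eq, smul_eq_mul]
    ring
  rw [hinterp]
  have hθ := hθ.1
  positivity

/-- The pointwise form of dissipativity: `⟪A v, D v⟫ ≥ 0` for the differential `D` of the radial
map at any point other than the origin, where the radial map need not be differentiable. -/
def IsPointwiseDissipative (φ : ℝ → ℝ) (A : E →L[ℝ] E) : Prop :=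
  ∀ z ≠ 0, ∀ v, 0 ≤ ⟪A v, fderiv ℝ (radialMap φ) z v⟫

namespace HasMonotoneIndex

variable {φ : ℝ → ℝ} {s : ℝ} {ω : E}

theorem fderiv_radialMap_axialStretch (hφ : HasMonotoneIndex φ) (hs : 0 < s) (hω : ‖ω‖ = 1)
    (l : E) :
    fderiv ℝ (radialMap φ) (s • ω) (axialStretch (lambdaOfIndex (logIndex φ s)) ω l) =
      φ s • axialStretch (-lambdaOfIndex (logIndex φ s)) ω l := by
  rw [fderiv_radialMap_smul (hφ.hasDerivAt hs).differentiableAt (hφ.pos s hs).ne' hs hω,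
    axialStretch_lambdaOfIndex (hφ.neg_one_lt_logIndex hs) hω]

theorem isPointwiseDissipative_iff_dissForm (hφ : HasMonotoneIndex φ) :
    IsPointwiseDissipative φ A ↔ ∀ s > 0, ∀ l ω : E, ‖ω‖ = 1 →
      0 ≤ dissForm A (lambdaOfIndex (logIndex φ s)) l ω := by
  refine ⟨fun h s hs l ω hω => ?_, fun h z hz v => ?_⟩
  · have hne : s • ω ≠ 0 := smul_ne_zero hs.ne' (norm_ne_zero_iff.mp (hω.symm ▸ one_ne_zero))
    have := h _ hne (axialStretch (lambdaOfIndex (logIndex φ s)) ω l)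
    rw [hφ.fderiv_radialMap_axialStretch hs hω, real_inner_smul_right] at this
    exact nonneg_of_mul_nonneg_right this (hφ.pos s hs)
  · obtain ⟨s, hs, ω, hω, rfl⟩ : ∃ s > 0, ∃ ω : E, ‖ω‖ = 1 ∧ s • ω = z :=
      ⟨‖z‖, norm_pos_iff.mpr hz, ‖z‖⁻¹ • z, norm_smul_inv_norm hz,
        smul_inv_smul₀ (norm_ne_zero_iff.mpr hz) z⟩
    obtain ⟨l, rfl⟩ :=
      surjective_axialStretch_lambdaOfIndex (hφ.neg_one_lt_logIndex hs) hω v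
    rw [hφ.fderiv_radialMap_axialStretch hs hω, real_inner_smul_right]
    exact mul_nonneg (hφ.pos _ hs).le (h s hs l ω hω)

theorem fderiv_radialMap_self (hφ : HasMonotoneIndex φ) {v : E} (hv : v ≠ 0) :
    fderiv ℝ (radialMap φ) v v = (φ ‖v‖ * (1 + logIndex φ ‖v‖)) • v := by
  have hn := norm_pos_iff.mpr hv
  have hφn := hφ.pos _ hn
  rw [fderiv_radialMap_apply (hφ.hasDerivAt hn) hv, real_inner_self_eq_norm_sq, ← add_smul,
    logIndex]
  congr 1
  field_simp

theorem inner_self_nonneg (hφ : HasMonotoneIndex φ) (h : IsPointwiseDissipative φ A) (v : E) :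
    0 ≤ ⟪A v, v⟫ := by
  rcases eq_or_ne v 0 with rfl | hv
  · rw [inner_zero_right]
  have hn := norm_pos_iff.mpr hv
  have := h v hv v
  rw [hφ.fderiv_radialMap_self hv, real_inner_smul_right] at this
  exact nonneg_of_mul_nonneg_right this
    (mul_pos (hφ.pos _ hn) (by linarith [hφ.neg_one_lt_logIndex hn]))

theorem isPointwiseDissipative_iff_dissForm_limit (hφ : HasMonotoneIndex φ)
    (hE : ∀ l : E, l ≠ 0 → ∃ ω : E, ‖ω‖ = 1 ∧ ⟪ω, l⟫ = 0)
    (hL : Tendsto (fun s => lambdaOfIndex (logIndex φ s)) atTop (𝓝 L))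
    (hseg : ∀ s ∈ Ioi 0, lambdaOfIndex (logIndex φ s) ∈ segment ℝ 0 L) :
    IsPointwiseDissipative φ A ↔ ∀ l ω : E, ‖ω‖ = 1 → 0 ≤ dissForm A L l ω := by
  rw [hφ.isPointwiseDissipative_iff_dissForm]
  refine ⟨fun h l ω hω => ?_, fun h s hs l ω hω => ?_⟩
  · have hcont : Continuous fun c => dissForm A c l ω := by
      unfold dissForm axialStretch
      fun_prop
    refine ge_of_tendsto ((hcont.tendsto L).comp hL) ?_
    filter_upwards [eventually_gt_atTop 0] with s hs
    exact h s hs l ω hω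
  · have hself : ∀ v, 0 ≤ ⟪A v, v⟫ := fun v => by
      rcases eq_or_ne v 0 with rfl | hv
      · rw [inner_zero_right]
      obtain ⟨η, hη, hηv⟩ := hE v hv
      exact dissForm_eq_of_inner_eq_zero hηv ▸ h v η hη
    exact dissForm_nonneg_of_mem_segment (hseg s hs) (hself ω) (hself l) (h l ω hω)

end HasMonotoneIndex

end PointwiseForm

section TestFunction

variable {X F : Type*} [NormedAddCommGroup X] [NormedSpace ℝ X] [NormedAddCommGroup F]
  [NormedSpace ℝ F] {U K : Set X} {u : X → F}

/-- The continuously differentiable functions with compact support contained in `U`; for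
`ℂ^m`-valued functions of a real variable this is `IsTestFun`. -/
structure IsTestFunction (U : Set X) (u : X → F) : Prop where
  contDiff : ContDiff ℝ 1 u
  hasCompactSupport : HasCompactSupport u
  tsupport_subset : tsupport u ⊆ U

theorem IsTestFunction.of_support_subset (hK : IsCompact K) (hKU : K ⊆ U) (hu : ContDiff ℝ 1 u)
    (h : Function.support u ⊆ K) : IsTestFunction U u :=
  have htsupport : tsupport u ⊆ K := closure_minimal h hK.isClosed
  ⟨hu, hK.of_isClosed_subset (isClosed_tsupport u) htsupport, htsupport.trans hKU⟩

theorem IsTestFunction.mono {V : Set X} (hu : IsTestFunction U u) (hUV : U ⊆ V) :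
    IsTestFunction V u :=
  ⟨hu.contDiff, hu.hasCompactSupport, hu.tsupport_subset.trans hUV⟩

theorem IsTestFunction.comp_left {G : Type*} [NormedAddCommGroup G] [NormedSpace ℝ G]
    (hu : IsTestFunction U u) {w : F → G} (hw : ContDiff ℝ 1 w) (h0 : w 0 = 0) :
    IsTestFunction U (w ∘ u) :=
  ⟨hw.comp hu.contDiff, hu.hasCompactSupport.comp_left h0,
    (tsupport_comp_subset h0 u).trans hu.tsupport_subset⟩

theorem IsTestFunction.add {w : X → F} (hu : IsTestFunction U u) (hw : IsTestFunction U w) :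
    IsTestFunction U (u + w) :=
  ⟨hu.contDiff.add hw.contDiff, hu.hasCompactSupport.add hw.hasCompactSupport,
    (tsupport_add u w).trans (union_subset hu.tsupport_subset hw.tsupport_subset)⟩

theorem exists_isTestFunction_eventuallyEq_one [FiniteDimensional ℝ X] (hK : IsCompact K)
    (hU : IsOpen U) (hKU : K ⊆ U) :
    ∃ θ : X → ℝ, IsTestFunction U θ ∧ ∀ x ∈ K, θ =ᶠ[𝓝 x] 1 := by
  obtain ⟨K', hK', hKK', hK'U⟩ := exists_compact_between hK hU hKU
  obtain ⟨θ, hone, hzero, -⟩ := exists_contMDiffMap_one_nhds_of_subset_interior (n := 1)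
    (modelWithCornersSelf ℝ X) hK.isClosed hKK'
  have hsupport : Function.support θ ⊆ K' := Function.support_subset_iff'.mpr hzero
  exact ⟨θ, .of_support_subset hK' hK'U θ.contMDiff.contDiff hsupport,
    fun x hx => hone.filter_mono (nhds_le_nhdsSet hx)⟩

end TestFunction

section Integrability

variable {X : Type*} [TopologicalSpace X] [T2Space X] [SecondCountableTopology X]
  [MeasurableSpace X] [OpensMeasurableSpace X] {μ : Measure X} {K : Set X}

theorem integrableOn_bilin_of_continuousOn {E F G : Type*} [NormedAddCommGroup E]
    [NormedSpace ℝ E] [NormedAddCommGroup F] [NormedSpace ℝ F] [NormedAddCommGroup G]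
    [NormedSpace ℝ G] (B : E →L[ℝ] F →L[ℝ] G) {f : X → E} {g : X → F} (hK : IsCompact K)
    (hf : IntegrableOn f K μ) (hg : ContinuousOn g K) :
    IntegrableOn (fun x => B (f x) (g x)) K μ := by
  obtain ⟨C, hC⟩ := hK.exists_bound_of_continuousOn hg
  exact B.integrable_of_bilin_of_bdd_right C hf (hg.aestronglyMeasurable hK.measurableSet)
    (ae_restrict_of_forall_mem hK.measurableSet hC)

theorem integrableOn_inner_apply {E : Type*} [NormedAddCommGroup E] [InnerProductSpace ℝ E]
    {A : X → E →L[ℝ] E} {f g : X → E} (hK : IsCompact K) (hA : IntegrableOn A K μ)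
    (hf : ContinuousOn f K) (hg : ContinuousOn g K) :
    IntegrableOn (fun x => ⟪A x (f x), g x⟫) K μ :=
  integrableOn_bilin_of_continuousOn (innerSL ℝ) hK
    (integrableOn_bilin_of_continuousOn (.id ℝ (E →L[ℝ] E)) hK hA hf) hg

end Integrability

section Sufficiency

variable {E : Type*} [NormedAddCommGroup E] [InnerProductSpace ℝ E] {φ : ℝ → ℝ} {x : ℝ}

theorem sameRay_of_hasDerivAt_radialMap_comp {F : Type*} [NormedAddCommGroup F] [NormedSpace ℝ F]
    (hφ : ∀ s, 0 < s → 0 ≤ φ s) {u : ℝ → F} {u' w' : F} (hu : HasDerivAt u u' x)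
    (hw : HasDerivAt (radialMap φ ∘ u) w' x) (h0 : u x = 0) : SameRay ℝ u' w' := by
  rw [hasDerivAt_iff_tendsto_slope] at hu hw
  rw [sameRay_iff_norm_smul_eq]
  refine tendsto_nhds_unique (hu.norm.smul hw) ((hw.norm.smul hu).congr fun y => ?_)
  have hslope : slope (radialMap φ ∘ u) x y = φ ‖u y‖ • slope u x y := by
    simp only [slope, Function.comp_apply, h0, radialMap_zero, vsub_eq_sub, sub_zero]
    rw [radialMap, smul_comm]
  rcases eq_or_ne (u y) 0 with hy | hy
  · simp only [slope, Function.comp_apply, h0, hy, radialMap_zero, vsub_self, smul_zero]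
  · rw [hslope, norm_smul, Real.norm_of_nonneg (hφ _ (norm_pos_iff.mpr hy)), smul_smul, mul_comm]

/-- Functional dissipativity of `u ↦ (𝒜 u')'` on a real inner product space: the notion
`IsDissipative`, freed of coordinates and of the complex structure. -/
def IsRadiallyDissipative (φ : ℝ → ℝ) (I : Set ℝ) (𝒜 : ℝ → E →L[ℝ] E) : Prop :=
  ∀ u : ℝ → E, IsTestFunction I u → IsTestFunction I (radialMap φ ∘ u) →
    0 ≤ ∫ x in I, ⟪𝒜 x (deriv u x), deriv (radialMap φ ∘ u) x⟫

namespace HasMonotoneIndex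

variable {u : ℝ → E}

theorem contDiffAt_radialMap (hφ : HasMonotoneIndex φ) {z : E} (hz : z ≠ 0) :
    ContDiffAt ℝ 1 (radialMap φ) z :=
  FunctionalDissipativity.contDiffAt_radialMap (hφ.contDiffAt (norm_pos_iff.mpr hz)) hz

theorem deriv_radialMap_comp (hφ : HasMonotoneIndex φ) (hu : DifferentiableAt ℝ u x)
    (h0 : u x ≠ 0) :
    deriv (radialMap φ ∘ u) x = fderiv ℝ (radialMap φ) (u x) (deriv u x) :=
  fderiv_comp_deriv x ((hφ.contDiffAt_radialMap h0).differentiableAt one_ne_zero) hu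

theorem inner_deriv_radialMap_nonneg (hφ : HasMonotoneIndex φ) {A : E →L[ℝ] E}
    (h : IsPointwiseDissipative φ A) (hu : DifferentiableAt ℝ u x)
    (hw : DifferentiableAt ℝ (radialMap φ ∘ u) x) :
    0 ≤ ⟪A (deriv u x), deriv (radialMap φ ∘ u) x⟫ := by
  by_cases h0 : u x = 0
  · have hray := sameRay_of_hasDerivAt_radialMap_comp (fun s hs => (hφ.pos s hs).le) hu.hasDerivAt
      hw.hasDerivAt h0
    by_cases hu' : deriv u x = 0
    · rw [hu', map_zero, inner_zero_left]
    · obtain ⟨c, hc, hcu⟩ := hray.exists_nonneg_left hu'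
      rw [← hcu, real_inner_smul_right]
      exact mul_nonneg hc (hφ.inner_self_nonneg h _)
  · rw [hφ.deriv_radialMap_comp hu h0]
    exact h _ h0 _

theorem isRadiallyDissipative_of_ae (hφ : HasMonotoneIndex φ) {I : Set ℝ} (hI : MeasurableSet I)
    {𝒜 : ℝ → E →L[ℝ] E} (h : ∀ᵐ x : ℝ, x ∈ I → IsPointwiseDissipative φ (𝒜 x)) :
    IsRadiallyDissipative φ I 𝒜 := fun u hu hw => by
  refine integral_nonneg_of_ae ((ae_restrict_iff' hI).mpr ?_)
  filter_upwards [h] with x hx hxI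
  exact hφ.inner_deriv_radialMap_nonneg (hx hxI) (hu.contDiff.differentiable one_ne_zero x)
    (hw.contDiff.differentiable one_ne_zero x)

end HasMonotoneIndex

end Sufficiency

section Profile

theorem contDiff_comp_sq_of_lipschitzWith {F : Type*} [NormedAddCommGroup F] [NormedSpace ℝ F]
    {g : ℝ → F} {K : ℝ≥0} (hlip : LipschitzWith K g) (hg : ContDiffOn ℝ 1 g (Ioi 0)) :
    ContDiff ℝ 1 fun t => g (t ^ 2) := by
  have hderiv (t : ℝ) : HasDerivAt (fun t => g (t ^ 2)) ((2 * t) • deriv g (t ^ 2)) t := by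
    rcases eq_or_ne t 0 with rfl | ht
    · have hO : (fun t => g (t ^ 2) - g 0) =O[𝓝 0] fun t : ℝ => ‖t - 0‖ ^ 2 :=
        .of_bound K (.of_forall fun t => by
          rw [sub_zero, norm_pow, norm_norm, ← norm_pow]
          exact (hlip.norm_sub_le _ _).trans_eq (by rw [sub_zero]))
      simpa using (hO.hasFDerivAt one_lt_two).hasDerivAt
    · have h : HasDerivAt (fun t : ℝ => t ^ 2) (2 * t) t := by simpa using hasDerivAt_pow 2 t
      exact HasDerivAt.scomp (h := fun t => t ^ 2) t ((hg.contDiffAt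
        (Ioi_mem_nhds (sq_pos_of_ne_zero ht))).differentiableAt one_ne_zero).hasDerivAt h
  refine contDiff_one_iff_deriv.mpr ⟨fun t => (hderiv t).differentiableAt, ?_⟩
  rw [funext fun t => (hderiv t).deriv, continuous_iff_continuousAt]
  intro t
  rcases eq_or_ne t 0 with rfl | ht
  · rw [ContinuousAt, mul_zero, zero_smul]
    refine squeeze_zero_norm (a := fun t => ‖2 * t‖ * K) (fun t => ?_) ?_
    · rw [norm_smul]
      exact mul_le_mul_of_nonneg_left (norm_deriv_le_of_lipschitz hlip) (norm_nonneg _)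
    · have : Continuous fun t : ℝ => ‖2 * t‖ * K := by fun_prop
      simpa using this.tendsto 0
  · have hpos : 0 < t ^ 2 := sq_pos_of_ne_zero ht
    have h := (hg.continuousOn_deriv_of_isOpen isOpen_Ioi le_rfl).continuousAt (Ioi_mem_nhds hpos)
    exact (continuousAt_const.mul continuousAt_id).smul
      (h.comp (f := fun t : ℝ => t ^ 2) (continuousAt_id.pow 2))

theorem radialMap_smul {F : Type*} [NormedAddCommGroup F] [NormedSpace ℝ F] (φ : ℝ → ℝ) (r : ℝ)
    {e : F} (he : ‖e‖ = 1) : radialMap φ (r • e) = radialMap φ r • e := by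
  rw [radialMap, radialMap, norm_smul, he, mul_one, smul_assoc]

theorem radialMap_of_nonneg (φ : ℝ → ℝ) {s : ℝ} (hs : 0 ≤ s) : radialMap φ s = s * φ s := by
  rw [radialMap, Real.norm_of_nonneg hs, smul_eq_mul, mul_comm]

theorem radialMap_neg {F : Type*} [NormedAddCommGroup F] [NormedSpace ℝ F] (φ : ℝ → ℝ) (z : F) :
    radialMap φ (-z) = -radialMap φ z := by
  rw [radialMap, radialMap, norm_neg, smul_neg]

namespace HasMonotoneIndex

variable {φ : ℝ → ℝ}

theorem continuous_radialMap (hφ : HasMonotoneIndex φ) {F : Type*} [NormedAddCommGroup F]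
    [NormedSpace ℝ F] : Continuous (radialMap φ : F → F) := by
  refine continuous_iff_continuousAt.mpr fun z => ?_
  rcases eq_or_ne z 0 with rfl | hz
  · rw [continuousAt_iff_punctured_nhds, radialMap_zero, tendsto_zero_iff_norm_tendsto_zero]
    refine (hφ.tendsto_mul_self_zero.comp (tendsto_norm_nhdsNE_zero (E := F))).congr' ?_
    filter_upwards [self_mem_nhdsWithin] with y hy
    rw [radialMap, norm_smul, Real.norm_of_nonneg (hφ.pos _ (norm_pos_iff.mpr hy)).le, mul_comm]
    rfl
  · have hcont : ContinuousAt φ ‖z‖ := (hφ.contDiffAt (norm_pos_iff.mpr hz)).continuousAt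
    exact (hcont.comp continuous_norm.continuousAt).smul continuousAt_id

theorem strictMono_radialMap (hφ : HasMonotoneIndex φ) : StrictMono (radialMap φ : ℝ → ℝ) := by
  refine strictMono_of_odd_strictMonoOn_nonneg (radialMap_neg φ) fun s hs t ht hst => ?_
  rw [radialMap_of_nonneg φ hs, radialMap_of_nonneg φ ht]
  rcases eq_or_lt_of_le (mem_Ici.mp hs) with rfl | hs'
  · rw [zero_mul]
    exact mul_pos hst (hφ.pos t hst)
  · exact hφ.strictMonoOn_mul_self hs' (hs'.trans hst) hst

theorem surjective_add_radialMap (hφ : HasMonotoneIndex φ) :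
    Function.Surjective fun s : ℝ => s + radialMap φ s := by
  have hzero : radialMap φ (0 : ℝ) = 0 := radialMap_zero φ
  refine (continuous_id.add hφ.continuous_radialMap).surjective
    (tendsto_atTop_mono' atTop ?_ tendsto_id) (tendsto_atBot_mono' atBot ?_ tendsto_id)
  · filter_upwards [eventually_ge_atTop 0] with s hs
    exact le_add_of_nonneg_right (hzero ▸ hφ.strictMono_radialMap.monotone hs)
  · filter_upwards [eventually_le_atBot 0] with s hs
    exact add_le_of_nonpos_right (hzero ▸ hφ.strictMono_radialMap.monotone hs)

/-- The map `s ↦ s + φ(|s|)s` as an order isomorphism of the line. Both its inverse `g` and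
`radialMap φ ∘ g = id - g` are Lipschitz, whatever the behaviour of `φ` at `0`. -/
def addRadialIso (hφ : HasMonotoneIndex φ) : ℝ ≃o ℝ :=
  StrictMono.orderIsoOfSurjective (fun s => s + radialMap φ s)
    (strictMono_id.add hφ.strictMono_radialMap) hφ.surjective_add_radialMap

theorem addRadialIso_apply (hφ : HasMonotoneIndex φ) (s : ℝ) :
    hφ.addRadialIso s = s + radialMap φ s := rfl

theorem addRadialIso_zero (hφ : HasMonotoneIndex φ) : hφ.addRadialIso 0 = 0 := by
  rw [addRadialIso_apply, radialMap_zero, add_zero]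

theorem radialMap_addRadialIso_symm (hφ : HasMonotoneIndex φ) (y : ℝ) :
    radialMap φ (hφ.addRadialIso.symm y) = y - hφ.addRadialIso.symm y := by
  rw [eq_sub_iff_add_eq', ← addRadialIso_apply hφ, OrderIso.apply_symm_apply]

theorem lipschitzWith_addRadialIso_symm (hφ : HasMonotoneIndex φ) :
    LipschitzWith 1 hφ.addRadialIso.symm := by
  refine LipschitzWith.of_le_add fun x y => ?_
  rcases le_total x y with hxy | hxy
  · exact (hφ.addRadialIso.symm.monotone hxy).trans (le_add_of_nonneg_right dist_nonneg)
  · have h := hφ.strictMono_radialMap.monotone (hφ.addRadialIso.symm.monotone hxy)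
    rw [radialMap_addRadialIso_symm, radialMap_addRadialIso_symm] at h
    rw [Real.dist_eq, abs_of_nonneg (sub_nonneg.mpr hxy)]
    linarith

theorem contDiffOn_addRadialIso_symm (hφ : HasMonotoneIndex φ) :
    ContDiffOn ℝ 1 hφ.addRadialIso.symm (Ioi 0) := fun y hy => by
  set s := hφ.addRadialIso.symm y
  have hs : 0 < s := by
    rw [OrderIso.lt_symm_apply, addRadialIso_zero]
    exact hy
  have hsmul : HasDerivAt (fun t : ℝ => t * φ t) (deriv (fun t : ℝ => t * φ t) s) s :=
    (differentiableAt_fun_id.mul (hφ.hasDerivAt hs).differentiableAt).hasDerivAt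
  have heq : hφ.addRadialIso =ᶠ[𝓝 s] fun t => t + t * φ t := by
    filter_upwards [lt_mem_nhds hs] with t ht
    rw [addRadialIso_apply, radialMap_of_nonneg φ ht.le]
  have hderiv := ((hasDerivAt_id s).add hsmul).congr_of_eventuallyEq heq
  have hcont : ContDiffAt ℝ 1 hφ.addRadialIso s :=
    (contDiffAt_id.add (contDiffAt_id.mul (hφ.contDiffAt hs))).congr_of_eventuallyEq heq
  exact (hφ.addRadialIso.toHomeomorph.toOpenPartialHomeomorph.contDiffAt_symm_deriv
    (add_pos one_pos (hφ.deriv_pos s hs)).ne' (mem_univ y) hderiv hcont).contDiffWithinAt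

theorem exists_contDiff_profile (hφ : HasMonotoneIndex φ) {s : ℝ} (hs : 0 ≤ s) :
    ∃ ρ : ℝ → ℝ, ContDiff ℝ 1 ρ ∧ ContDiff ℝ 1 (radialMap φ ∘ ρ) ∧ ρ 0 = 0 ∧ ρ 1 = s := by
  set g := hφ.addRadialIso.symm
  have hg : ContDiff ℝ 1 fun t => g (t ^ 2) :=
    contDiff_comp_sq_of_lipschitzWith hφ.lipschitzWith_addRadialIso_symm
      hφ.contDiffOn_addRadialIso_symm
  set c := √(hφ.addRadialIso s)
  have hc : c ^ 2 = hφ.addRadialIso s := Real.sq_sqrt (by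
    rw [← hφ.addRadialIso_zero]
    exact hφ.addRadialIso.monotone hs)
  have hmul : ContDiff ℝ 1 fun t : ℝ => c * t := contDiff_const.mul contDiff_id
  refine ⟨fun t => g ((c * t) ^ 2), hg.comp hmul, ?_, ?_, ?_⟩
  · have hcomp : radialMap φ ∘ (fun t => g ((c * t) ^ 2)) =
        fun t => (c * t) ^ 2 - g ((c * t) ^ 2) := funext fun t => hφ.radialMap_addRadialIso_symm _
    rw [hcomp]
    exact (hmul.pow 2).sub (hg.comp hmul)
  · simp only [mul_zero, zero_pow two_ne_zero, g, OrderIso.symm_apply_eq, addRadialIso_zero]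
  · simp only [mul_one, hc, g, OrderIso.symm_apply_apply]

theorem exists_isTestFunction_eventuallyEq_const (hφ : HasMonotoneIndex φ) {X F : Type*}
    [NormedAddCommGroup X] [NormedSpace ℝ X] [FiniteDimensional ℝ X] [NormedAddCommGroup F]
    [NormedSpace ℝ F] {K U : Set X} (hK : IsCompact K) (hU : IsOpen U) (hKU : K ⊆ U) {z : F}
    (hz : z ≠ 0) :
    ∃ u : X → F, IsTestFunction U u ∧ IsTestFunction U (radialMap φ ∘ u) ∧
      ∀ x ∈ K, u =ᶠ[𝓝 x] fun _ => z := by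
  obtain ⟨θ, hθ, hone⟩ := exists_isTestFunction_eventuallyEq_one hK hU hKU
  obtain ⟨ρ, hρ, hφρ, hρ0, hρ1⟩ := hφ.exists_contDiff_profile (norm_nonneg z)
  set e := ‖z‖⁻¹ • z
  have he : ‖e‖ = 1 := by
    rw [norm_smul, norm_inv, norm_norm, inv_mul_cancel₀ (norm_ne_zero_iff.mpr hz)]
  refine ⟨(fun r => ρ r • e) ∘ θ, hθ.comp_left (hρ.smul contDiff_const) ?_, ?_, fun x hx => ?_⟩
  · rw [hρ0, zero_smul]
  · have hcomp : radialMap φ ∘ ((fun r => ρ r • e) ∘ θ) =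
        (fun r => (radialMap φ ∘ ρ) r • e) ∘ θ := funext fun x => radialMap_smul φ _ he
    rw [hcomp]
    refine hθ.comp_left (hφρ.smul contDiff_const) ?_
    rw [Function.comp_apply, hρ0, radialMap_zero, zero_smul]
  · filter_upwards [hone x hx] with y hy
    rw [Function.comp_apply, hy, Pi.one_apply, hρ1, smul_inv_smul₀ (norm_ne_zero_iff.mpr hz)]

end HasMonotoneIndex

end Profile

section Oscillation

/-- A cut-off wave of amplitude `1 / k`, frequency `k ^ 2` and phase `α`. -/
def oscillation (ζ : ℝ → ℝ) (α : ℝ) (k : ℕ) (x : ℝ) : ℝ :=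
  (k : ℝ)⁻¹ * (ζ x * Real.cos ((k : ℝ) ^ 2 * x + α))

/-- The derivative of `oscillation`, divided by `k` so that it stays bounded. -/
def oscillationSlope (ζ : ℝ → ℝ) (α : ℝ) (k : ℕ) (x : ℝ) : ℝ :=
  (k : ℝ)⁻¹ ^ 2 * (deriv ζ x * Real.cos ((k : ℝ) ^ 2 * x + α))
    - ζ x * Real.sin ((k : ℝ) ^ 2 * x + α)

variable {ζ : ℝ → ℝ} {α : ℝ} {k : ℕ} {x C : ℝ} {K : Set ℝ}

theorem IsTestFunction.exists_abs_le_and_abs_deriv_le (hζ : IsTestFunction K ζ) :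
    ∃ C, ∀ x, |ζ x| ≤ C ∧ |deriv ζ x| ≤ C := by
  obtain ⟨C₀, hC₀⟩ := hζ.hasCompactSupport.exists_bound_of_continuous hζ.contDiff.continuous
  obtain ⟨C₁, hC₁⟩ := hζ.hasCompactSupport.deriv.exists_bound_of_continuous
    (hζ.contDiff.continuous_deriv le_rfl)
  exact ⟨max C₀ C₁, fun x => ⟨le_max_of_le_left (hC₀ x), le_max_of_le_right (hC₁ x)⟩⟩

theorem isTestFunction_oscillation (hζ : IsTestFunction K ζ) (α : ℝ) (k : ℕ) :
    IsTestFunction K (oscillation ζ α k) := by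
  have hζ1 := hζ.contDiff
  have hsupport : Function.support (oscillation ζ α k) ⊆ tsupport ζ := fun x hx =>
    subset_tsupport ζ fun h => hx (by rw [oscillation, h, zero_mul, mul_zero])
  refine .of_support_subset hζ.hasCompactSupport hζ.tsupport_subset ?_ hsupport
  unfold oscillation
  fun_prop

theorem deriv_oscillation (hζ : DifferentiableAt ℝ ζ x) (hk : k ≠ 0) :
    deriv (oscillation ζ α k) x = k * oscillationSlope ζ α k x := by
  have hphase : HasDerivAt (fun x : ℝ => (k : ℝ) ^ 2 * x + α) ((k : ℝ) ^ 2) x := by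
    simpa using ((hasDerivAt_id x).const_mul ((k : ℝ) ^ 2)).add_const α
  refine (((hζ.hasDerivAt.mul hphase.cos).const_mul (k : ℝ)⁻¹).deriv).trans ?_
  rw [oscillationSlope]
  field_simp
  ring

theorem continuous_oscillationSlope (hζ : ContDiff ℝ 1 ζ) (α : ℝ) (k : ℕ) :
    Continuous (oscillationSlope ζ α k) := by
  have := hζ.continuous
  have := hζ.continuous_deriv le_rfl
  unfold oscillationSlope
  fun_prop

theorem abs_oscillation_le (hC : |ζ x| ≤ C) : |oscillation ζ α k x| ≤ (k : ℝ)⁻¹ * C := by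
  rw [oscillation, abs_mul, abs_mul, abs_of_nonneg (by positivity : (0 : ℝ) ≤ (k : ℝ)⁻¹)]
  gcongr
  exact (mul_le_of_le_one_right (abs_nonneg _) (Real.abs_cos_le_one _)).trans hC

theorem abs_oscillationSlope_le (hC : |ζ x| ≤ C) (hC' : |deriv ζ x| ≤ C) :
    |oscillationSlope ζ α k x| ≤ 2 * C := by
  have hk : (k : ℝ)⁻¹ ^ 2 ≤ 1 := pow_le_one₀ (by positivity) (Nat.cast_inv_le_one k)
  have hcos : |deriv ζ x * Real.cos ((k : ℝ) ^ 2 * x + α)| ≤ C := by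
    rw [abs_mul]
    exact (mul_le_of_le_one_right (abs_nonneg _) (Real.abs_cos_le_one _)).trans hC'
  have hsin : |ζ x * Real.sin ((k : ℝ) ^ 2 * x + α)| ≤ C := by
    rw [abs_mul]
    exact (mul_le_of_le_one_right (abs_nonneg _) (Real.abs_sin_le_one _)).trans hC
  have hkcos : |(k : ℝ)⁻¹ ^ 2 * (deriv ζ x * Real.cos ((k : ℝ) ^ 2 * x + α))| ≤ C := by
    rw [abs_mul, abs_of_nonneg (by positivity : (0 : ℝ) ≤ (k : ℝ)⁻¹ ^ 2)]
    exact (mul_le_of_le_one_left (abs_nonneg _) hk).trans hcos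
  exact (abs_sub _ _).trans (by linarith)

-- Phases `0` and `π / 2` turn the oscillating `cos ^ 2` and `sin ^ 2` into `cos ^ 2 + sin ^ 2`.
theorem oscillationSlope_sq_add_sq (ζ : ℝ → ℝ) (k : ℕ) (x : ℝ) :
    oscillationSlope ζ 0 k x ^ 2 + oscillationSlope ζ (Real.pi / 2) k x ^ 2 =
      ζ x ^ 2 + (k : ℝ)⁻¹ ^ 4 * deriv ζ x ^ 2 := by
  simp only [oscillationSlope, Real.cos_add_pi_div_two, Real.sin_add_pi_div_two, add_zero]
  linear_combination (ζ x ^ 2 + (k : ℝ)⁻¹ ^ 4 * deriv ζ x ^ 2) *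
    Real.sin_sq_add_cos_sq ((k : ℝ) ^ 2 * x)

theorem tendsto_oscillationSlope_sq_mul_sub {y : ℕ → ℝ} {l : ℝ} (hy : Tendsto y atTop (𝓝 l)) :
    Tendsto (fun k => oscillationSlope ζ α k x ^ 2 * (y k - l)) atTop (𝓝 0) := by
  set C := max |ζ x| |deriv ζ x|
  have hbound : Tendsto (fun k => (2 * C) ^ 2 * |y k - l|) atTop (𝓝 0) := by
    simpa using (hy.sub_const l).abs.const_mul ((2 * C) ^ 2)
  refine squeeze_zero_norm (fun k => ?_) hbound
  rw [norm_mul, norm_pow, Real.norm_eq_abs, Real.norm_eq_abs]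
  gcongr
  exact abs_oscillationSlope_le (le_max_left _ _) (le_max_right _ _)

theorem tendsto_oscillationSlope_sq_mul_add {y₀ y₁ : ℕ → ℝ} {l : ℝ}
    (h₀ : Tendsto y₀ atTop (𝓝 l)) (h₁ : Tendsto y₁ atTop (𝓝 l)) :
    Tendsto (fun k => oscillationSlope ζ 0 k x ^ 2 * y₀ k +
      oscillationSlope ζ (Real.pi / 2) k x ^ 2 * y₁ k) atTop (𝓝 (ζ x ^ 2 * l)) := by
  have hsum : Tendsto (fun k => (oscillationSlope ζ 0 k x ^ 2 +
      oscillationSlope ζ (Real.pi / 2) k x ^ 2) * l) atTop (𝓝 (ζ x ^ 2 * l)) := by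
    simp only [oscillationSlope_sq_add_sq]
    simpa using (((tendsto_inv_atTop_nhds_zero_nat.pow 4).mul_const (deriv ζ x ^ 2)).const_add
      (ζ x ^ 2)).mul_const l
  have h := ((tendsto_oscillationSlope_sq_mul_sub (ζ := ζ) (α := 0) (x := x) h₀).add
    (tendsto_oscillationSlope_sq_mul_sub (ζ := ζ) (α := Real.pi / 2) (x := x) h₁)).add hsum
  rw [zero_add, zero_add] at h
  exact h.congr fun k => by ring

theorem tendsto_oscillation (ζ : ℝ → ℝ) (α x : ℝ) :
    Tendsto (fun k => oscillation ζ α k x) atTop (𝓝 0) :=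
  squeeze_zero_norm (fun _ => abs_oscillation_le le_rfl)
    (by simpa using tendsto_inv_atTop_nhds_zero_nat.mul_const |ζ x|)

theorem eventually_forall_abs_oscillation_lt (hC : ∀ x, |ζ x| ≤ C) {ε : ℝ} (hε : 0 < ε) :
    ∀ᶠ k in atTop, ∀ α x, |oscillation ζ α k x| < ε := by
  have h : Tendsto (fun k : ℕ => (k : ℝ)⁻¹ * C) atTop (𝓝 0) := by
    simpa using tendsto_inv_atTop_nhds_zero_nat.mul_const C
  filter_upwards [h.eventually_lt_const hε] with k hk α x
  exact (abs_oscillation_le (hC x)).trans_lt hk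

variable {E : Type*} [NormedAddCommGroup E] [InnerProductSpace ℝ E] {a g : ℝ → E} {δ c : ℝ}

/-- The energy density `S'² ⟪a, g ∘ S⟫` of `S = oscillation ζ α k`, divided by `k ^ 2`. -/
def oscillationEnergy (a g : ℝ → E) (ζ : ℝ → ℝ) (α : ℝ) (k : ℕ) (x : ℝ) : ℝ :=
  oscillationSlope ζ α k x ^ 2 * ⟪a x, g (oscillation ζ α k x)⟫

theorem integrableOn_oscillationEnergy (hK : IsCompact K) (ha : IntegrableOn a K)
    (hg : ContinuousOn g (Ioo (-δ) δ)) (hζ : IsTestFunction K ζ)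
    (hδ : ∀ x, |oscillation ζ α k x| < δ) : IntegrableOn (oscillationEnergy a g ζ α k) K := by
  have hgS : Continuous fun x => g (oscillation ζ α k x) :=
    hg.comp_continuous (isTestFunction_oscillation hζ α k).contDiff.continuous
      fun x => abs_lt.mp (hδ x)
  refine (integrableOn_bilin_of_continuousOn (innerSL ℝ) hK ha
    (((continuous_oscillationSlope hζ.contDiff α k).pow 2).smul hgS).continuousOn).congr_fun
      (fun x _ => ?_) hK.measurableSet
  exact real_inner_smul_right _ _ _

theorem abs_oscillationEnergy_le {M : ℝ} (hC : |ζ x| ≤ C) (hC' : |deriv ζ x| ≤ C)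
    (hM : ‖g (oscillation ζ α k x)‖ ≤ M) :
    |oscillationEnergy a g ζ α k x| ≤ (2 * C) ^ 2 * (‖a x‖ * M) := by
  rw [oscillationEnergy, abs_mul, abs_pow]
  gcongr
  · exact abs_oscillationSlope_le hC hC'
  · exact (abs_real_inner_le_norm _ _).trans (by gcongr)

theorem tendsto_integral_oscillationEnergy (hK : IsCompact K) (ha : IntegrableOn a K)
    (hδ : 0 < δ) (hg : ContinuousOn g (Ioo (-δ) δ)) (hζ : IsTestFunction K ζ) :
    Tendsto (fun k => (∫ x in K, oscillationEnergy a g ζ 0 k x) +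
      ∫ x in K, oscillationEnergy a g ζ (Real.pi / 2) k x) atTop
      (𝓝 (∫ x in K, ζ x ^ 2 * ⟪a x, g 0⟫)) := by
  obtain ⟨C, hC⟩ := hζ.exists_abs_le_and_abs_deriv_le
  have hg0 : ContinuousAt g 0 := hg.continuousAt (Ioo_mem_nhds (neg_lt_zero.mpr hδ) hδ)
  obtain ⟨ε, hε, hgε⟩ := Metric.eventually_nhds_iff.mp
    (hg0.norm.eventually_le_const (lt_add_one ‖g 0‖))
  have hint : ∀ᶠ k in atTop, ∀ α, IntegrableOn (oscillationEnergy a g ζ α k) K := by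
    filter_upwards [eventually_forall_abs_oscillation_lt (fun x => (hC x).1) hδ] with k hk α
    exact integrableOn_oscillationEnergy hK ha hg hζ (hk α)
  have hbound : ∀ᶠ k in atTop, ∀ α x,
      |oscillationEnergy a g ζ α k x| ≤ (2 * C) ^ 2 * (‖a x‖ * (‖g 0‖ + 1)) := by
    filter_upwards [eventually_forall_abs_oscillation_lt (fun x => (hC x).1) hε] with k hk α x
    exact abs_oscillationEnergy_le (hC x).1 (hC x).2 (hgε (by simpa using hk α x))
  have hlim (α x : ℝ) :
      Tendsto (fun k => ⟪a x, g (oscillation ζ α k x)⟫) atTop (𝓝 ⟪a x, g 0⟫) :=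
    tendsto_const_nhds.inner (hg0.tendsto.comp (tendsto_oscillation ζ α x))
  have hdom := tendsto_integral_filter_of_dominated_convergence (μ := volume.restrict K)
    (F := fun k x => oscillationEnergy a g ζ 0 k x + oscillationEnergy a g ζ (Real.pi / 2) k x)
    (fun x => (2 * C) ^ 2 * (‖a x‖ * (‖g 0‖ + 1)) + (2 * C) ^ 2 * (‖a x‖ * (‖g 0‖ + 1)))
    (hint.mono fun k hk => ((hk _).add (hk _)).aestronglyMeasurable)
    (hbound.mono fun k hk => .of_forall fun x =>
      (norm_add_le _ _).trans (add_le_add (hk _ x) (hk _ x)))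
    (((ha.norm.mul_const _).const_mul _).add ((ha.norm.mul_const _).const_mul _))
    (.of_forall fun x => tendsto_oscillationSlope_sq_mul_add (hlim _ x) (hlim _ x))
  refine hdom.congr' ?_
  filter_upwards [hint] with k hk
  exact integral_add (hk _) (hk _)

theorem integral_sq_mul_inner_nonneg_of_deriv_sq (hK : IsCompact K) (ha : IntegrableOn a K)
    (hδ : 0 < δ) (hg : ContinuousOn g (Ioo (-δ) δ))
    (h : ∀ S, IsTestFunction K S → (∀ x, |S x| < δ) →
      0 ≤ c + ∫ x in K, deriv S x ^ 2 * ⟪a x, g (S x)⟫)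
    (hζ : IsTestFunction K ζ) : 0 ≤ ∫ x in K, ζ x ^ 2 * ⟪a x, g 0⟫ := by
  obtain ⟨C, hC⟩ := hζ.exists_abs_le_and_abs_deriv_le
  have hlower : ∀ᶠ k : ℕ in atTop, ∀ α,
      0 ≤ (k : ℝ)⁻¹ ^ 2 * c + ∫ x in K, oscillationEnergy a g ζ α k x := by
    filter_upwards [eventually_forall_abs_oscillation_lt (fun x => (hC x).1) hδ,
      eventually_ne_atTop 0] with k hk hk0 α
    have hkpos : 0 < (k : ℝ) ^ 2 := by positivity
    have hS := h _ (isTestFunction_oscillation hζ α k) (hk α)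
    have henergy (x : ℝ) : deriv (oscillation ζ α k) x ^ 2 * ⟪a x, g (oscillation ζ α k x)⟫ =
        (k : ℝ) ^ 2 * oscillationEnergy a g ζ α k x := by
      rw [deriv_oscillation (hζ.contDiff.differentiable one_ne_zero x) hk0, oscillationEnergy]
      ring
    simp only [henergy, integral_const_mul] at hS
    refine nonneg_of_mul_nonneg_right (a := (k : ℝ) ^ 2) (hS.trans_eq ?_) hkpos
    field_simp
  have hlim := ((((tendsto_inv_atTop_nhds_zero_nat (𝕜 := ℝ)).pow 2).mul_const (2 * c)).add
    (tendsto_integral_oscillationEnergy hK ha hδ hg hζ))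
  rw [zero_pow two_ne_zero, zero_mul, zero_add] at hlim
  refine ge_of_tendsto hlim ?_
  filter_upwards [hlower] with k hk
  linarith [hk 0, hk (Real.pi / 2)]

end Oscillation

section Lebesgue

open Metric

theorem ae_mem_imp_of_forall_isCompact {X : Type*} [TopologicalSpace X] [LocallyCompactSpace X]
    [SecondCountableTopology X] [MeasurableSpace X] {μ : Measure X} {U : Set X} (hU : IsOpen U)
    {P : X → Prop} (h : ∀ K ⊆ U, IsCompact K → ∀ᵐ x ∂μ, x ∈ interior K → P x) :
    ∀ᵐ x ∂μ, x ∈ U → P x := by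
  refine measure_null_of_locally_null _ fun x hx => ?_
  obtain ⟨hxU, -⟩ := Classical.not_imp.mp hx
  obtain ⟨K, hK, hxK, hKU⟩ := exists_compact_subset hU hxU
  refine ⟨_, ?_, h K hKU hK⟩
  filter_upwards [self_mem_nhdsWithin, mem_nhdsWithin_of_mem_nhds (isOpen_interior.mem_nhds hxK)]
    with y hy hyK hP
  exact hy fun _ => hP hyK

variable {G : Type*} [NormedAddCommGroup G] [NormedSpace ℝ G] [FiniteDimensional ℝ G]
  [MeasurableSpace G] [BorelSpace G] {μ : Measure G} [μ.IsAddHaarMeasure]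

theorem integrable_contDiffBump_sq {x : G} (b : ContDiffBump x) :
    Integrable (fun y => b y ^ 2) μ := by
  have hsupport : HasCompactSupport fun y => b y ^ 2 :=
    b.hasCompactSupport.mono fun y hy h => hy (by simp only [h, zero_pow two_ne_zero])
  exact (b.continuous.pow 2).integrable_of_hasCompactSupport hsupport

theorem measureReal_closedBall_le_integral_contDiffBump_sq {x : G} (b : ContDiffBump x) :
    μ.real (closedBall x b.rIn) ≤ ∫ y, b y ^ 2 ∂μ :=
  calc μ.real (closedBall x b.rIn) = ∫ _ in closedBall x b.rIn, 1 ∂μ := by simp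
    _ = ∫ y in closedBall x b.rIn, b y ^ 2 ∂μ :=
      setIntegral_congr_fun measurableSet_closedBall fun y hy => by
        rw [b.one_of_mem_closedBall hy, one_pow]
    _ ≤ ∫ y, b y ^ 2 ∂μ :=
      setIntegral_le_integral (integrable_contDiffBump_sq b) (.of_forall fun y => sq_nonneg _)

theorem contDiffBump_sq_div_integral_le {x : G} (b : ContDiffBump x) {C : ℝ}
    (hb : b.rOut ≤ C * b.rIn) (y : G) :
    |b y ^ 2 / ∫ w, b w ^ 2 ∂μ| ≤
      C ^ Module.finrank ℝ G / μ.real (closedBall x b.rOut) := by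
  have hC : 0 < C := pos_of_mul_pos_left (b.rOut_pos.trans_le hb) b.rIn_pos.le
  have hpos {r : ℝ} (hr : 0 < r) : 0 < μ.real (closedBall x r) :=
    ENNReal.toReal_pos (measure_closedBall_pos μ x hr).ne' measure_closedBall_lt_top.ne
  have hint := measureReal_closedBall_le_integral_contDiffBump_sq (μ := μ) b
  have hscale : μ.real (closedBall x b.rOut) ≤
      C ^ Module.finrank ℝ G * μ.real (closedBall x b.rIn) := by
    rw [Measure.addHaar_real_closedBall' _ _ b.rIn_pos.le,
      Measure.addHaar_real_closedBall' _ _ b.rOut_pos.le,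
      ← mul_assoc, ← mul_pow]
    gcongr
    exact b.rOut_pos.le
  rw [abs_of_nonneg (div_nonneg (sq_nonneg _) (integral_nonneg fun _ => sq_nonneg _)),
    div_le_div_iff₀ ((hpos b.rIn_pos).trans_le hint) (hpos b.rOut_pos)]
  calc b y ^ 2 * μ.real (closedBall x b.rOut) ≤ 1 * μ.real (closedBall x b.rOut) := by
        gcongr
        exact pow_le_one₀ b.nonneg b.le_one
    _ ≤ C ^ Module.finrank ℝ G * μ.real (closedBall x b.rIn) := by rwa [one_mul]
    _ ≤ C ^ Module.finrank ℝ G * ∫ w, b w ^ 2 ∂μ := by gcongr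

theorem tendsto_integral_contDiffBump_sq_smul {F : Type*} [NormedAddCommGroup F]
    [NormedSpace ℝ F] [CompleteSpace F] {f : G → F} (hf : LocallyIntegrable f μ) {x : G}
    (hx : Tendsto (fun r => ⨍ y in closedBall x r, ‖f y - f x‖ ∂μ) (𝓝[>] 0) (𝓝 0))
    {ι : Type*} {l : Filter ι} {b : ι → ContDiffBump x}
    (hb : Tendsto (fun i => (b i).rOut) l (𝓝 0)) {C : ℝ}
    (hC : ∀ᶠ i in l, (b i).rOut ≤ C * (b i).rIn) :
    Tendsto (fun i => ∫ y, (b i y ^ 2 / ∫ w, b i w ^ 2 ∂μ) • f y ∂μ) l (𝓝 (f x)) := by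
  have hb' : Tendsto (fun i => (b i).rOut) l (𝓝[>] 0) :=
    tendsto_nhdsWithin_iff.mpr ⟨hb, .of_forall fun i => (b i).rOut_pos⟩
  refine tendsto_integral_smul_of_tendsto_average_norm_sub (C ^ Module.finrank ℝ G)
    (hx.comp hb') (.of_forall fun i => hf.integrableOn_isCompact (isCompact_closedBall _ _))
    (tendsto_const_nhds.congr fun i => ?_) (.of_forall fun i y hy => ?_)
    (hC.mono fun i hi => contDiffBump_sq_div_integral_le _ hi)
  · have hpos : 0 < ∫ w, b i w ^ 2 ∂μ :=
      (ENNReal.toReal_pos (measure_closedBall_pos μ x (b i).rIn_pos).ne'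
        measure_closedBall_lt_top.ne).trans_le
          (measureReal_closedBall_le_integral_contDiffBump_sq _)
    rw [integral_div, div_self hpos.ne']
  · refine ball_subset_closedBall ((b i).support_eq ▸ fun h => hy ?_)
    simp only [h, zero_pow two_ne_zero, zero_div]

theorem ae_nonneg_of_forall_integral_sq_mul_nonneg {K : Set G} (hK : MeasurableSet K) {f : G → ℝ}
    (hf : IntegrableOn f K μ)
    (h : ∀ ζ, IsTestFunction K ζ → 0 ≤ ∫ x in K, ζ x ^ 2 * f x ∂μ) :
    ∀ᵐ x ∂μ, x ∈ interior K → 0 ≤ f x := by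
  have hint : LocallyIntegrable (K.indicator f) μ :=
    ((integrable_indicator_iff hK).mpr hf).locallyIntegrable
  filter_upwards [(Besicovitch.vitaliFamily μ).ae_tendsto_average_norm_sub hint] with x hx hxK
  let b (n : ℕ) : ContDiffBump x :=
    ⟨1 / (n + 1), 2 * (1 / (n + 1)), Nat.one_div_pos_of_nat, by
      linarith [Nat.one_div_pos_of_nat (α := ℝ) (n := n)]⟩
  have hb : Tendsto (fun n => (b n).rOut) atTop (𝓝 0) := by
    have h := (tendsto_one_div_add_atTop_nhds_zero_nat (𝕜 := ℝ)).const_mul 2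
    rwa [mul_zero] at h
  have hlim := tendsto_integral_contDiffBump_sq_smul hint
    (hx.comp (Besicovitch.tendsto_filterAt μ x)) hb (.of_forall fun n => le_rfl)
  rw [indicator_of_mem (interior_subset hxK)] at hlim
  obtain ⟨ε, hε, hεK⟩ := nhds_basis_closedBall.mem_iff.mp (mem_interior_iff_mem_nhds.mp hxK)
  refine ge_of_tendsto hlim ?_
  filter_upwards [hb.eventually_le_const hε] with n hn
  have htest : IsTestFunction K (b n) :=
    ⟨(b n).contDiff, (b n).hasCompactSupport,
      (b n).tsupport_eq ▸ (closedBall_subset_closedBall hn).trans hεK⟩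
  have hsmul (y : G) : (b n y ^ 2 / ∫ w, b n w ^ 2 ∂μ) • K.indicator f y =
      (∫ w, b n w ^ 2 ∂μ)⁻¹ * K.indicator (fun y => b n y ^ 2 * f y) y := by
    rw [indicator_mul_right, smul_eq_mul]
    ring
  simp only [hsmul, integral_const_mul, integral_indicator hK]
  exact mul_nonneg (inv_nonneg.mpr (integral_nonneg fun _ => sq_nonneg _)) (h _ htest)

end Lebesgue

section Necessity

theorem HasMonotoneIndex.isTestFunction_radialMap_comp {X E : Type*} [NormedAddCommGroup X]
    [NormedSpace ℝ X] [NormedAddCommGroup E] [InnerProductSpace ℝ E] {φ : ℝ → ℝ}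
    (hφ : HasMonotoneIndex φ) {U : Set X} {u : X → E} (hu : IsTestFunction U u)
    (h : ∀ x, u x = 0 → ContDiffAt ℝ 1 (radialMap φ ∘ u) x) :
    IsTestFunction U (radialMap φ ∘ u) := by
  refine .of_support_subset hu.hasCompactSupport hu.tsupport_subset
    (contDiff_iff_contDiffAt.mpr fun x => ?_)
    ((Function.support_comp_subset (radialMap_zero φ) u).trans (subset_tsupport u))
  by_cases hx : u x = 0
  · exact h x hx
  · exact (hφ.contDiffAt_radialMap hx).comp x hu.contDiff.contDiffAt

variable {E : Type*} [NormedAddCommGroup E] [InnerProductSpace ℝ E] {φ : ℝ → ℝ}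
  {I K : Set ℝ} {𝒜 : ℝ → E →L[ℝ] E} {z : E}

theorem IsTestFunction.integrableOn_inner_deriv {u w : ℝ → E} (hI : MeasurableSet I)
    (h𝒜 : LocallyIntegrableOn 𝒜 I) (hu : IsTestFunction I u) (hw : ContDiff ℝ 1 w) :
    IntegrableOn (fun x => ⟪𝒜 x (deriv u x), deriv w x⟫) I := by
  have hK : IsCompact (tsupport u) := hu.hasCompactSupport
  refine (integrableOn_inner_apply hK (h𝒜.integrableOn_compact_subset hu.tsupport_subset hK)
    (hu.contDiff.continuous_deriv le_rfl).continuousOn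
    (hw.continuous_deriv le_rfl).continuousOn).of_forall_sdiff_eq_zero hI fun x hx => ?_
  rw [Function.notMem_support.mp (notMem_subset support_deriv_subset hx.2), map_zero,
    inner_zero_left]

theorem IsRadiallyDissipative.exists_add_integral_deriv_sq_nonneg (hφ : HasMonotoneIndex φ)
    (hI : IsOpen I) (h𝒜 : LocallyIntegrableOn 𝒜 I) (hdiss : IsRadiallyDissipative φ I 𝒜)
    (hK : IsCompact K) (hKI : K ⊆ I) (hz : z ≠ 0) (v : E) :
    ∃ c : ℝ, ∀ S, IsTestFunction K S → (∀ x, z + S x • v ≠ 0) →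
      0 ≤ c + ∫ x in K, deriv S x ^ 2 *
        ⟪𝒜 x v, fderiv ℝ (radialMap φ) (z + S x • v) v⟫ := by
  obtain ⟨u₀, hu₀, hw₀, hz₀⟩ := hφ.exists_isTestFunction_eventuallyEq_const hK hI hKI hz
  refine ⟨∫ x in I \ K, ⟪𝒜 x (deriv u₀ x), deriv (radialMap φ ∘ u₀) x⟫, fun S hS hne => ?_⟩
  let u : ℝ → E := u₀ + (fun t : ℝ => t • v) ∘ S
  have hoff {x : ℝ} (hx : x ∉ K) : u =ᶠ[𝓝 x] u₀ := by
    filter_upwards [notMem_tsupport_iff_eventuallyEq.mp (notMem_subset hS.tsupport_subset hx)]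
      with y hy
    simp only [u, Pi.add_apply, Function.comp_apply, hy, Pi.zero_apply, zero_smul, add_zero]
  have hon {x : ℝ} (hx : x ∈ K) : u =ᶠ[𝓝 x] fun y => z + S y • v := by
    filter_upwards [hz₀ x hx] with y hy
    simp only [u, Pi.add_apply, Function.comp_apply, hy]
  have hu : IsTestFunction I u := hu₀.add
    ((hS.comp_left (contDiff_id.smul contDiff_const) (zero_smul ℝ v)).mono hKI)
  have hw : IsTestFunction I (radialMap φ ∘ u) := by
    refine hφ.isTestFunction_radialMap_comp hu fun x hx => ?_
    have hxK : x ∉ K := fun hxK => hne x ((hon hxK).eq_of_nhds ▸ hx)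
    exact hw₀.contDiff.contDiffAt.congr_of_eventuallyEq ((hoff hxK).fun_comp _)
  have hderiv {x : ℝ} (hx : x ∈ K) : deriv u x = deriv S x • v := by
    rw [(hon hx).deriv_eq, deriv_const_add, deriv_smul_const]
    exact hS.contDiff.differentiable one_ne_zero x
  have hnonneg := hdiss u hu hw
  rw [← integral_inter_add_sdiff hK.measurableSet
      (hu.integrableOn_inner_deriv hI.measurableSet h𝒜 hw.contDiff),
    inter_eq_self_of_subset_right hKI, add_comm] at hnonneg
  convert hnonneg using 2
  · refine setIntegral_congr_fun (hI.measurableSet.diff hK.measurableSet) fun x hx => ?_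
    simp only [(hoff hx.2).deriv_eq, ((hoff hx.2).fun_comp (radialMap φ)).deriv_eq]
  · refine setIntegral_congr_fun hK.measurableSet fun x hx => ?_
    have hux : u x = z + S x • v := (hon hx).eq_of_nhds
    simp only [hφ.deriv_radialMap_comp (hu.contDiff.differentiable one_ne_zero x)
      (hux ▸ hne x), hux, hderiv hx, map_smul, real_inner_smul_left, real_inner_smul_right]
    ring

theorem IsRadiallyDissipative.ae_inner_fderiv_radialMap_nonneg (hφ : HasMonotoneIndex φ)
    (hI : IsOpen I) (h𝒜 : LocallyIntegrableOn 𝒜 I) (hdiss : IsRadiallyDissipative φ I 𝒜)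
    (hz : z ≠ 0) (v : E) :
    ∀ᵐ x : ℝ, x ∈ I → 0 ≤ ⟪𝒜 x v, fderiv ℝ (radialMap φ) z v⟫ := by
  have hcont : ContinuousAt (fun t : ℝ => z + t • v) 0 := by fun_prop
  obtain ⟨δ, hδ, hne⟩ := Metric.eventually_nhds_iff.mp (hcont.eventually_ne (y := 0) (by simpa))
  simp only [dist_zero_right, Real.norm_eq_abs] at hne
  have hg : ContinuousOn (fun t : ℝ => fderiv ℝ (radialMap φ) (z + t • v) v)
      (Ioo (-δ) δ) := by
    intro t ht
    have hfderiv : ContinuousAt (fun t : ℝ => fderiv ℝ (radialMap φ) (z + t • v)) t :=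
      ContinuousAt.comp (f := fun t : ℝ => z + t • v)
        ((hφ.contDiffAt_radialMap (hne (abs_lt.mpr ht))).continuousAt_fderiv one_ne_zero)
        (by fun_prop)
    exact (hfderiv.clm_apply continuousAt_const).continuousWithinAt
  refine ae_mem_imp_of_forall_isCompact hI fun K hKI hK => ?_
  have ha : IntegrableOn (fun x => 𝒜 x v) K :=
    (ContinuousLinearMap.apply ℝ E v).integrable_comp (h𝒜.integrableOn_compact_subset hKI hK)
  obtain ⟨c, hc⟩ := hdiss.exists_add_integral_deriv_sq_nonneg hφ hI h𝒜 hK hKI hz v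
  refine ae_nonneg_of_forall_integral_sq_mul_nonneg hK.measurableSet (ha.inner_const _)
    fun ζ hζ => ?_
  have hint := integral_sq_mul_inner_nonneg_of_deriv_sq hK ha hδ hg
    (fun S hS hSδ => hc S hS fun x => hne (hSδ x)) hζ
  simpa only [zero_smul, add_zero] using hint

theorem HasMonotoneIndex.continuousOn_inner_fderiv_radialMap (hφ : HasMonotoneIndex φ)
    (A : E →L[ℝ] E) :
    ContinuousOn (fun p : E × E => ⟪A p.2, fderiv ℝ (radialMap φ) p.1 p.2⟫)
      {p | p.1 ≠ 0} := fun p hp => by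
  have hfderiv : ContinuousAt (fun p : E × E => fderiv ℝ (radialMap φ) p.1) p :=
    ((hφ.contDiffAt_radialMap hp).continuousAt_fderiv one_ne_zero).comp continuousAt_fst
  exact ((A.continuous.comp continuous_snd).continuousAt.inner
    (hfderiv.clm_apply continuousAt_snd)).continuousWithinAt

theorem IsRadiallyDissipative.ae_isPointwiseDissipative
    [TopologicalSpace.SeparableSpace E] (hφ : HasMonotoneIndex φ) (hI : IsOpen I)
    (h𝒜 : LocallyIntegrableOn 𝒜 I) (hdiss : IsRadiallyDissipative φ I 𝒜) :
    ∀ᵐ x : ℝ, x ∈ I → IsPointwiseDissipative φ (𝒜 x) := by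
  obtain ⟨D, hD, hDd⟩ := TopologicalSpace.exists_countable_dense (E × E)
  have hall : ∀ᵐ x : ℝ, ∀ p ∈ D, p.1 ≠ 0 → x ∈ I →
      0 ≤ ⟪𝒜 x p.2, fderiv ℝ (radialMap φ) p.1 p.2⟫ := by
    refine (ae_ball_iff hD).mpr fun p _ => ?_
    by_cases hp : p.1 = 0
    · exact .of_forall fun _ h => absurd hp h
    · filter_upwards [hdiss.ae_inner_fderiv_radialMap_nonneg hφ hI h𝒜 hp p.2] with x hx _ using hx
  filter_upwards [hall] with x hx hxI z hz v
  have hopen : IsOpen {p : E × E | p.1 ≠ 0} := isOpen_ne.preimage continuous_fst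
  have hzv : (z, v) ∈ {p : E × E | p.1 ≠ 0} := hz
  have hmem : (z, v) ∈ closure ({p : E × E | p.1 ≠ 0} ∩ D) :=
    hDd.open_subset_closure_inter hopen hzv
  have hcont := (hφ.continuousOn_inner_fderiv_radialMap (𝒜 x)).continuousAt (hopen.mem_nhds hzv)
  exact isClosed_Ici.closure_subset (hcont.continuousWithinAt.mem_closure hmem
    fun p hp => hx p hp.2 hp.1 hxI)

end Necessity

section ComplexSystem

variable {m : ℕ} {φ : ℝ → ℝ} {I : Set ℝ} {𝒜 : ℝ → Matrix (Fin m) (Fin m) ℂ}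

theorem isOpen_openInterval (a b : EReal) : IsOpen (openInterval a b) :=
  (isOpen_lt continuous_const continuous_coe_real_ereal).inter
    (isOpen_lt continuous_coe_real_ereal continuous_const)

theorem re_sprod (x y : Cvec m) : (sprod x y).re = ⟪x, y⟫ := by
  rw [real_inner_comm]
  simp only [sprod, PiLp.inner_apply, Complex.re_sum]
  rfl

theorem im_sprod (x y : Cvec m) : (sprod x y).im = ⟪x, Complex.I • y⟫ := by
  rw [← re_sprod, sprod, sprod, inner_smul_left, Complex.conj_I, neg_mul, Complex.neg_re,
    Complex.I_mul_re, neg_neg]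

theorem exists_norm_eq_one_inner_eq_zero {l : Cvec m} (hl : l ≠ 0) :
    ∃ ω : Cvec m, ‖ω‖ = 1 ∧ ⟪ω, l⟫ = 0 := by
  refine ⟨‖l‖⁻¹ • Complex.I • l, ?_, ?_⟩
  · rw [norm_smul, norm_inv, norm_norm, norm_smul, Complex.norm_I, one_mul,
      inv_mul_cancel₀ (norm_ne_zero_iff.mpr hl)]
  · rw [real_inner_smul_left, real_inner_comm, ← im_sprod, sprod]
    exact mul_eq_zero_of_right _ (inner_self_im (𝕜 := ℂ) l)

/-- The action of complex matrices on `ℂ^m`, as real-linear operators depending real-linearly on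
the matrix. -/
def matCLM : Matrix (Fin m) (Fin m) ℂ →ₗ[ℝ] Cvec m →L[ℝ] Cvec m where
  toFun M := (Matrix.toEuclideanCLM (n := Fin m) (𝕜 := ℂ) M).restrictScalars ℝ
  map_add' M N := by rw [map_add]; rfl
  map_smul' c M := by rw [← Complex.coe_smul, map_smul]; rfl

theorem matCLM_apply (M : Matrix (Fin m) (Fin m) ℂ) (v : Cvec m) : matCLM M v = matVec M v := rfl

theorem locallyIntegrableOn_matCLM (hI : IsLocallyClosed I)
    (h𝒜 : ∀ i j, LocallyIntegrableOn (fun x => 𝒜 x i j) I) :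
    LocallyIntegrableOn (fun x => matCLM (𝒜 x)) I := by
  refine (locallyIntegrableOn_iff hI).mpr fun K hKI hK => ?_
  let T : (Fin m → Fin m → ℂ) →L[ℝ] Cvec m →L[ℝ] Cvec m :=
    LinearMap.toContinuousLinearMap (matCLM ∘ₗ (Matrix.ofLinearEquiv ℝ).toLinearMap)
  exact T.integrable_comp (Integrable.of_eval fun i => Integrable.of_eval fun j =>
    (h𝒜 i j).integrableOn_compact_subset hKI hK)

theorem re_integral_sprod {X : Type*} [MeasurableSpace X] {μ : Measure X} {f g : X → Cvec m}
    (hre : Integrable (fun x => ⟪f x, g x⟫) μ)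
    (him : Integrable (fun x => ⟪f x, Complex.I • g x⟫) μ) :
    (∫ x, sprod (f x) (g x) ∂μ).re = ∫ x, ⟪f x, g x⟫ ∂μ := by
  simp only [← im_sprod] at him
  simp only [← re_sprod] at hre ⊢
  exact (integral_re (𝕜 := ℂ) (Integrable.re_im_iff.mp ⟨hre, him⟩)).symm

theorem isTestFun_iff_isTestFunction {u : ℝ → Cvec m} : IsTestFun I u ↔ IsTestFunction I u :=
  ⟨fun h => ⟨h.1, h.2.1, h.2.2⟩, fun h => ⟨h.1, h.2, h.3⟩⟩

theorem re_integral_sprod_matVec_deriv (hI : MeasurableSet I)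
    (h𝒜 : LocallyIntegrableOn (fun x => matCLM (𝒜 x)) I) {u w : ℝ → Cvec m}
    (hu : IsTestFunction I u) (hw : ContDiff ℝ 1 w) :
    (∫ x in I, sprod (matVec (𝒜 x) (deriv u x)) (deriv w x)).re =
      ∫ x in I, ⟪matCLM (𝒜 x) (deriv u x), deriv w x⟫ := by
  refine re_integral_sprod (hu.integrableOn_inner_deriv hI h𝒜 hw) ?_
  have hderiv (x : ℝ) : deriv (fun y => Complex.I • w y) x = Complex.I • deriv w x :=
    deriv_fun_const_smul _ (hw.differentiable one_ne_zero x)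
  simpa only [IntegrableOn, hderiv, matCLM_apply] using
    hu.integrableOn_inner_deriv hI h𝒜 (hw.const_smul Complex.I)

theorem isDissipative_iff_isRadiallyDissipative (hI : MeasurableSet I)
    (h𝒜 : LocallyIntegrableOn (fun x => matCLM (𝒜 x)) I) :
    IsDissipative φ I 𝒜 ↔ IsRadiallyDissipative φ I fun x => matCLM (𝒜 x) := by
  have hre (u : ℝ → Cvec m) (hu : IsTestFunction I u) (hw : IsTestFunction I (radialMap φ ∘ u)) :=
    re_integral_sprod_matVec_deriv hI h𝒜 hu hw.contDiff
  simp only [IsDissipative, IsRadiallyDissipative, isTestFun_iff_isTestFunction]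
  exact forall₃_congr fun u hu hw => by rw [← hre u hu hw]; rfl

theorem HasMonotoneIndex.isDissipative_iff_ae_isPointwiseDissipative (hφ : HasMonotoneIndex φ)
    (hI : IsOpen I) (h𝒜 : ∀ i j, LocallyIntegrableOn (fun x => 𝒜 x i j) I) :
    IsDissipative φ I 𝒜 ↔ ∀ᵐ x : ℝ, x ∈ I → IsPointwiseDissipative φ (matCLM (𝒜 x)) := by
  have h𝒜' := locallyIntegrableOn_matCLM hI.isLocallyClosed h𝒜
  rw [isDissipative_iff_isRadiallyDissipative hI.measurableSet h𝒜']
  exact ⟨fun h => h.ae_isPointwiseDissipative hφ hI h𝒜',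
    hφ.isRadiallyDissipative_of_ae hI.measurableSet⟩

theorem dissForm_matCLM (M : Matrix (Fin m) (Fin m) ℂ) (L : ℝ) (l ω : Cvec m) :
    dissForm (matCLM M) L l ω = (sprod (matVec M l) l).re
      - L ^ 2 * (sprod (matVec M ω) ω).re * (sprod l ω).re ^ 2
      + L * (sprod (matVec M ω) l - sprod (matVec M l) ω).re * (sprod l ω).re := by
  simp only [dissForm_eq, Complex.sub_re, re_sprod, matCLM_apply, real_inner_comm l ω]

end ComplexSystem

end FunctionalDissipativity

end

open FunctionalDissipativity in
theorem mainTheorem4_general {φ : ℝ → ℝ} (hφ : HasMonotoneIndex φ) {I : Set ℝ} (hI : IsOpen I)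
    {m : ℕ} {𝒜 : ℝ → Matrix (Fin m) (Fin m) ℂ}
    (h𝒜 : ∀ i j, LocallyIntegrableOn (fun x => 𝒜 x i j) I) :
    ∃ Λinf : ℝ, Tendsto (Lambda φ) atTop (𝓝 Λinf) ∧
      (IsDissipative φ I 𝒜 ↔ ∀ᵐ x : ℝ, x ∈ I → ∀ l ω : Cvec m, ‖ω‖ = 1 →
        0 ≤ (sprod (matVec (𝒜 x) l) l).re
          - Λinf ^ 2 * (sprod (matVec (𝒜 x) ω) ω).re * (sprod l ω).re ^ 2
          + Λinf * (sprod (matVec (𝒜 x) ω) l - sprod (matVec (𝒜 x) l) ω).re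
            * (sprod l ω).re) := by
  obtain ⟨L, hL, hseg⟩ := hφ.exists_tendsto_lambdaOfIndex
  refine ⟨L, hφ.tendsto_Lambda hL, ?_⟩
  simp only [hφ.isDissipative_iff_ae_isPointwiseDissipative hI h𝒜, ← dissForm_matCLM,
    hφ.isPointwiseDissipative_iff_dissForm_limit (fun _ => exists_norm_eq_one_inner_eq_zero)
      hL hseg]

theorem mainTheorem4 (φ : ℝ → ℝ) (hφ : FunctionalDissipativity.Admissible φ)
    (a b : EReal) (m : ℕ) (𝒜 : ℝ → Matrix (Fin m) (Fin m) ℂ)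
    (h𝒜 : ∀ i j, LocallyIntegrableOn (fun x => 𝒜 x i j)
      (FunctionalDissipativity.openInterval a b) volume) :
    ∃ Λinf : ℝ, Tendsto (FunctionalDissipativity.Lambda φ) atTop (𝓝 Λinf) ∧
      (FunctionalDissipativity.IsDissipative φ (FunctionalDissipativity.openInterval a b) 𝒜 ↔
        ∀ᵐ x : ℝ, x ∈ FunctionalDissipativity.openInterval a b →
          ∀ l ω : FunctionalDissipativity.Cvec m, ‖ω‖ = 1 →
            0 ≤ (FunctionalDissipativity.sprod (FunctionalDissipativity.matVec (𝒜 x) l) l).re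
              - Λinf ^ 2
                * (FunctionalDissipativity.sprod (FunctionalDissipativity.matVec (𝒜 x) ω) ω).re
                * (FunctionalDissipativity.sprod l ω).re ^ 2
              + Λinf
                * (FunctionalDissipativity.sprod (FunctionalDissipativity.matVec (𝒜 x) ω) l
                  - FunctionalDissipativity.sprod (FunctionalDissipativity.matVec (𝒜 x) l) ω).re
                * (FunctionalDissipativity.sprod l ω).re) :=
  mainTheorem4_general hφ.hasMonotoneIndex (FunctionalDissipativity.isOpen_openInterval a b) h𝒜
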